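/- **Theorem (spatial decay of the Kalman gain).** Consider on $L^2(\mathbb R)$ the spatially invariant plant $\dot\psi=\mathcal A\psi+\mathcal B w$ with noisy measurements of the full state $y=\psi+\mathcal G v$, where $w,v$ are independent white noises with identity covariance. Here $\mathcal A$ is a densely defined constant-coefficient differential operator on its natural domain which generates a $C_0$-semigroup, with polynomial Fourier symbol $\hat{\mathcal A}_\lambda$; $\mathcal B,\mathcal G$ are bounded operators whose Fourier symbols are proper rational functions without zeros and without real poles, $\hat{\mathcal B}_\lambda=b/p_{\mathcal B}(\lambda)$, $\hat{\mathcal G}_\lambda=g/p_{\mathcal G}(\lambda)$, with $b,g\neq0$ and $p_{\mathcal B},p_{\mathcal G}$ polynomials without real roots. Let $\mathcal P$ be a self-adjoint stabilizing solution of the filtering algebraic Riccati equation $\langle(\mathcal A\mathcal P+\mathcal P\mathcal A^*+\mathcal B\mathcal B^*-\mathcal P(\mathcal G\mathcal G^*)^{-1}\mathcal P)h,f\rangle=0$, $h,f\in D(\mathcal A^*)$ (the quadratic term being read as $\langle \mathcal G^{-1}\mathcal P h,\mathcal G^{-1}\mathcal P f\rangle$; stabilizing means that the closed loop $\mathcal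 A-\mathcal L$ is exponentially stable, in the sense that $\mathcal A^*-\mathcal L^*$ generates an exponentially stable $C_0$-semigroup), where $\mathcal L=\mathcal P(\mathcal G\mathcal G^*)^{-1}$, with domain the range of $\mathcal G\mathcal G^*$, is the Kalman gain. Then $\mathcal L$ has the Fourier symbol $$\hat{\mathcal L}_\lambda=\Re\hat{\mathcal A}_\lambda+\sqrt{(\Re\hat{\mathcal A}_\lambda)^2+|\hat{\mathcal B}_\lambda/\hat{\mathcal G}_\lambda|^2},\qquad\lambda\in\mathbb R.$$ Let $Q(z)$ and $R(z)$ be the polynomial $\Re\hat{\mathcal A}_\lambda$ and the rational function $(\Re\hat{\mathcal A}_\lambda)^2+|\hat{\mathcal B}_\lambda/\hat{\mathcal G}_\lambda|^2$ of $\lambda$, with $\lambda$ replaced by $-\mathbf i z$, $z\in\mathbb C$. Call the zeros and the poles of $R$ the finite branch points of the extended symbol, and let $\theta$ be the minimum of $|\Re z_i|$ over the finite branch points $z_i$ ($\theta=\infty$ if there are none). Then there are only finitely many finite branch points, $\theta>0$, and: i) there is an analytic function $\hat{\mathcal L}_z$ on the strip $|\Re z|<\theta$ with $\hat{\mathcal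 L}_{\mathbf i\lambda}$ equal to the symbol $\hat{\mathcal L}_\lambda$ for all real $\lambda$, and such that $\hat{\mathcal L}_z-Q(z)$ is a square root of $R(z)$ (wherever the denominator of $R$ does not vanish); ii) for every compact $\Gamma_0\subset(-\theta,\theta)$ there are $C,N>0$ with $|\hat{\mathcal L}_z|\le C(1+|z|)^N$ whenever $\Re z\in\Gamma_0$; iii) $\mathcal L$ is the convolution operator on Schwartz functions with a tempered distribution $L$ as its kernel, and $e^{-\eta x}L$ is a tempered distribution for every real $\eta$ with $|\eta|<\theta$ (the sense in which the gain kernel decays exponentially in space, at every rate below $\theta$). -/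

import Mathlib

open MeasureTheory Filter Topology Polynomial FourierTransform ComplexConjugate
open scoped SchwartzMap LinearPMap NNReal ENNReal

noncomputable section

namespace KalmanGain

/-- The state space `L²(ℝ)`, with complex scalars. -/
abbrev L2R : Type := Lp (α := ℝ) ℂ 2 volume

/-! ### Strongly continuous semigroups -/

/-- A strongly continuous (`C₀`) semigroup of bounded operators on `X`. -/
structure C0Semigroup (X : Type*) [NormedAddCommGroup X] [NormedSpace ℂ X] where
  op : ℝ≥0 → X →L[ℂ] X
  op_zero : op 0 = ContinuousLinearMap.id ℂ X
  op_add : ∀ s t : ℝ≥0, op (s + t) = (op s).comp (op t)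
  tendsto_op : ∀ x : X, Tendsto (fun t : ℝ≥0 => op t x) (𝓝[>] 0) (𝓝 x)

namespace C0Semigroup

variable {X : Type*} [NormedAddCommGroup X] [NormedSpace ℂ X]

/-- `A` is the infinitesimal generator of `T`: `x ∈ D(A)` and `A x = y` exactly when
`(T(t) x - x) / t → y` as `t ↓ 0`. -/
def IsGenerator (T : C0Semigroup X) (A : X →ₗ.[ℂ] X) : Prop :=
  ∀ x y : X, (x, y) ∈ A.graph ↔
    Tendsto (fun t : ℝ≥0 => ((t : ℝ) : ℂ)⁻¹ • (T.op t x - x)) (𝓝[>] 0) (𝓝 y)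

/-- Exponential stability: `‖T(t)‖ ≤ M e^{-ω t}` for some `ω > 0`. -/
def IsExponentiallyStable (T : C0Semigroup X) : Prop :=
  ∃ M ω : ℝ, 0 < ω ∧ ∀ t : ℝ≥0, ‖T.op t‖ ≤ M * Real.exp (-ω * t)

end C0Semigroup

/-! ### Fourier symbols

The spatial frequency is `lam`, dual to `x` through `e^{-i lam x}`; the Fourier transform `𝓕` of
Mathlib uses `e^{-2 π i ξ x}`, so `lam = 2 π ξ`. The normalization in front of the integral plays
no role for multipliers. -/

/-- The operator `T` is diagonalized by the Fourier transform, with symbol `m`: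
`(T f)^(lam) = m(lam) * f^(lam)` for `f ∈ D(T)`. -/
def HasFourierSymbol (T : L2R →ₗ.[ℂ] L2R) (m : ℝ → ℂ) : Prop :=
  ∀ f y : L2R, (f, y) ∈ T.graph →
    ∀ᵐ ξ : ℝ, (𝓕 y : L2R) ξ = m (2 * Real.pi * ξ) * (𝓕 f : L2R) ξ

/-- The bounded operator `T` on all of `L²(ℝ)` has Fourier symbol `m`. -/
def HasBoundedFourierSymbol (T : L2R →L[ℂ] L2R) (m : ℝ → ℂ) : Prop :=
  ∀ f : L2R, ∀ᵐ ξ : ℝ, (𝓕 (T f) : L2R) ξ = m (2 * Real.pi * ξ) * (𝓕 f : L2R) ξ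

/-- `A` is the constant coefficient differential operator on `L²(ℝ)` with polynomial Fourier
symbol `a`, on its natural domain `{f ∈ L² : a(lam) f^(lam) ∈ L²}`. -/
def IsDifferentialOperator (A : L2R →ₗ.[ℂ] L2R) (a : ℂ[X]) : Prop :=
  ∀ f y : L2R, (f, y) ∈ A.graph ↔
    ∀ᵐ ξ : ℝ, (𝓕 y : L2R) ξ =
      a.eval ((2 * Real.pi * ξ : ℝ) : ℂ) * (𝓕 f : L2R) ξ

/-! ### The Kalman gain, for noisy measurements of the full state (`C = I`) -/

/-- The inverse `(G G*)⁻¹`, with domain the range of `G G*`. -/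
def noiseCovInv (G : L2R →L[ℂ] L2R) : L2R →ₗ.[ℂ] L2R :=
  LinearPMap.inverse
    (((G.comp (ContinuousLinearMap.adjoint G) : L2R →L[ℂ] L2R) : L2R →ₗ[ℂ] L2R).toPMap ⊤)

/-- The Kalman gain operator `L = P C* (G G*)⁻¹` with `C = I`. -/
def kalmanGain (G P : L2R →L[ℂ] L2R) : L2R →ₗ.[ℂ] L2R :=
  (P : L2R →ₗ[ℂ] L2R).compPMap (noiseCovInv G)

/-- The algebraic Riccati equation
`⟨(A P + P A* + B B* - P C* (G G*)⁻¹ C P) h, f⟩ = 0` for all `h, f ∈ D(A*)`, with `C = I`.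
Since `(G G*)⁻¹` may be unbounded, the quadratic term is read as the form
`⟨(G G*)⁻¹ P h, P f⟩ = ⟨G⁻¹ P h, G⁻¹ P f⟩`; here `u = G⁻¹ P h` and `w = G⁻¹ P f`.
(Mathlib's `inner ℂ` is conjugate linear in its first argument.) -/
def SatisfiesRiccati (A : L2R →ₗ.[ℂ] L2R) (B G P : L2R →L[ℂ] L2R) : Prop :=
  ∀ h h' f f' : L2R, (h, h') ∈ A†.graph → (f, f') ∈ A†.graph →
    ∃ u w : L2R, G u = P h ∧ G w = P f ∧
      inner ℂ f' (P h) + inner ℂ (P f) h'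
        + inner ℂ (ContinuousLinearMap.adjoint B f) (ContinuousLinearMap.adjoint B h)
        - inner ℂ w u = 0

/-- `P` is a stabilizing solution of the Riccati equation: it is self-adjoint, satisfies the
equation, and the closed loop `A - L C`, `C = I`, is exponentially stable. The closed loop
semigroup is given through its adjoint, whose generator is `A* - C* L*`: the operator
`L* = (G G*)⁻¹ P` is closed, whereas `L = P (G G*)⁻¹` need not be when `(G G*)⁻¹` is unbounded. -/
structure IsStabilizingSolution (A : L2R →ₗ.[ℂ] L2R) (B G P : L2R →L[ℂ] L2R) : Prop where
  selfAdjoint : IsSelfAdjoint P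
  riccati : SatisfiesRiccati A B G P
  stabilizing : ∃ V : C0Semigroup L2R,
    V.IsGenerator (A† - (kalmanGain G P)†) ∧ V.IsExponentiallyStable

/-! ### The symbols of the plant, the symbol of the gain and its extension -/

/-- The Fourier symbols of the plant: `A^(lam) = a(lam)` is a polynomial, and
`B^(lam) = b / pB(lam)`, `G^(lam) = g / pG(lam)` are the proper rational functions of `lam` without
zeros and without real poles. -/
structure PlantSymbols where
  a : ℂ[X]
  b : ℂ
  pB : ℂ[X]
  g : ℂ
  pG : ℂ[X]
  b_ne_zero : b ≠ 0
  g_ne_zero : g ≠ 0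
  pB_ne_zero : ∀ lam : ℝ, pB.eval (lam : ℂ) ≠ 0
  pG_ne_zero : ∀ lam : ℝ, pG.eval (lam : ℂ) ≠ 0

/-- The polynomial with conjugate coefficients. On the real line, its values are the conjugates of
those of `p`. -/
def conjPoly (p : ℂ[X]) : ℂ[X] := p.map (starRingEnd ℂ)

namespace PlantSymbols

variable (S : PlantSymbols)

/-- `B^(lam)`. -/
def symbB (lam : ℝ) : ℂ := S.b / S.pB.eval (lam : ℂ)

/-- `G^(lam)`. -/
def symbG (lam : ℝ) : ℂ := S.g / S.pG.eval (lam : ℂ)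

/-- The symbol of the gain,
`L^(lam) = Re A^(lam) + √((Re A^(lam))² + |B^(lam) / G^(lam)|²)`. -/
def gainSymbol (lam : ℝ) : ℝ :=
  (S.a.eval (lam : ℂ)).re
    + √((S.a.eval (lam : ℂ)).re ^ 2 + ‖S.symbB lam / S.symbG lam‖ ^ 2)

/-- `lam ↦ Re A^(lam)` as a polynomial in `lam`. -/
def rePoly : ℂ[X] := C (1 / 2) * (S.a + conjPoly S.a)

/-- `Re A^(lam)` with `lam` replaced by `-i z`. -/
def reExt (z : ℂ) : ℂ := S.rePoly.eval (-Complex.I * z)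

/-- `(Re A^(lam))² + |B^(lam) / G^(lam)|²` with `lam` replaced by `-i z`, where
`|B^ / G^|² = (|b|² |pG|²) / (|g|² |pB|²)` is a rational function of `lam`. -/
def radicandExt (z : ℂ) : ℂ :=
  S.reExt z ^ 2 +
    ((‖S.b‖ : ℂ) ^ 2 * (S.pG * conjPoly S.pG).eval (-Complex.I * z)) /
      ((‖S.g‖ : ℂ) ^ 2 * (S.pB * conjPoly S.pB).eval (-Complex.I * z))

/-- The finite branch points of the extension of the gain symbol: the zeros and the poles of the
extended radicand. Limits make the definition independent of common factors of the numerator and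
the denominator. -/
def branchPoints : Set ℂ :=
  {z₀ | Tendsto S.radicandExt (𝓝[≠] z₀) (𝓝 0) ∨
    Tendsto (fun z => ‖S.radicandExt z‖) (𝓝[≠] z₀) atTop}

/-- `θ`, the least `|Re z|` over the finite branch points (`∞` if there are none). -/
def decayRate : ℝ≥0∞ := ⨅ z ∈ S.branchPoints, ENNReal.ofReal |z.re|

/-- The strip `|Re z| < θ`. -/
def strip : Set ℂ := {z | ENNReal.ofReal |z.re| < S.decayRate}

/-- `F` is an extension of the gain symbol to the strip, under `lam ↦ -i z`: it is obtained from
the formula of the symbol by a choice of a square root of the extended radicand at each point, and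
it agrees with the symbol on the imaginary axis `z = i lam`. -/
def IsGainExtension (F : ℂ → ℂ) : Prop :=
  (∀ z ∈ S.strip, (S.pB * conjPoly S.pB).eval (-Complex.I * z) ≠ 0 →
      (F z - S.reExt z) ^ 2 = S.radicandExt z) ∧
    ∀ lam : ℝ, F (Complex.I * lam) = (S.gainSymbol lam : ℂ)

end PlantSymbols

/-! ### Convolution kernels and exponential weights -/

/-- The tempered distribution `L` is the convolution kernel of the operator `T`: every Schwartz
function `φ` is in `D(T)`, and `(T φ)(x) = ∫ L(x - ξ) φ(ξ) dξ = ⟨L, φ(x - ·)⟩` for almost every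
`x`. -/
def IsConvolutionKernel (T : L2R →ₗ.[ℂ] L2R) (L : 𝓢'(ℝ, ℂ)) : Prop :=
  ∀ φ : 𝓢(ℝ, ℂ), ∃ y : L2R, (φ.toLp 2 volume, y) ∈ T.graph ∧
    ∀ᵐ x : ℝ, ∀ ψ : 𝓢(ℝ, ℂ), (∀ s : ℝ, ψ s = φ (x - s)) → y x = L ψ

/-- The distribution `e^{-η x} L`, which acts on test functions `φ` (smooth with compact support)
by `φ ↦ ⟨L, e^{-η x} φ⟩`, is (the restriction to test functions of) a tempered distribution. -/
def IsTemperedWithWeight (η : ℝ) (L : 𝓢'(ℝ, ℂ)) : Prop :=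
  ∃ T : 𝓢'(ℝ, ℂ), ∀ φ ψ : 𝓢(ℝ, ℂ), HasCompactSupport φ →
    (∀ x : ℝ, ψ x = (Real.exp (-η * x) : ℂ) * φ x) → T φ = L ψ

end KalmanGain

end

open KalmanGain

namespace KalmanGain

/-! ### Band-limited Fourier multipliers -/

section BandMultiplier

/-! Write `ℓ` for the claimed gain symbol. At each frequency the Riccati equation is the scalar
quadratic `ℓ² = 2 Re(a) ℓ + |B^/G^|²`, whose larger root is the stabilizing one, with `P^ = |G^|²
ℓ`. However, `P` is not assumed to be spatially invariant, so this computation only produces a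
candidate and `P` must be shown to equal it.

On a frequency band every symbol is bounded, hence so is the candidate. The difference `D` of `P`
and the candidate satisfies a homogeneous Sylvester equation (`sylvester_eq_zero`). Consequently `⟨D
y(t), V(t) h⟩` is constant in time, where `y` is the multiplier flow with symbol `conj a - ℓ` and
`V` is the closed-loop semigroup. The flow is contractive and `V(t) h → 0`, so the constant is zero.
Since such `h` are dense, `D` vanishes on the band (`apply_band_of_stabilizing`); the bands then
exhaust all frequencies.

For the extension, reduce the radicand to lowest terms `n / d`. Neither polynomial vanishes in the
strip, which lies on one side of the vertical line through each root. Principal roots of the linear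
factors therefore multiply to an analytic square root. Its sign is fixed on the imaginary axis,
where the radicand is positive (`exists_analytic_sqrt_radicand`).

The kernel `L` is the inverse Fourier transform of the symbol. Against a test function, whose
Laplace transform is entire and rapidly decreasing on vertical strips, the contour can be moved from
`Re z = 0` to `Re z = η`. This identifies `e^{-ηx} L` with the inverse transform of a polynomially
bounded function (`isTemperedWithWeight_kernel`). -/

theorem exists_fourier_multiplier (m : ℝ → ℂ) (hm : MemLp m ∞ volume) :
    ∃ T : L2R →L[ℂ] L2R, ∀ f : L2R, (𝓕 (T f) : L2R) =ᵐ[volume] fun ξ => m ξ * (𝓕 f : L2R) ξ := by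
  let U := Lp.fourierTransformₗᵢ ℝ ℂ
  let M : L2R →L[ℂ] L2R := (ContinuousLinearMap.mul ℂ ℂ).holderL volume ∞ 2 2 (hm.toLp m)
  refine ⟨(U.symm.toContinuousLinearEquiv : L2R →L[ℂ] L2R) ∘L M ∘L
    (U.toContinuousLinearEquiv : L2R →L[ℂ] L2R), fun f => ?_⟩
  have h1 : (𝓕 (((U.symm.toContinuousLinearEquiv : L2R →L[ℂ] L2R) ∘L M ∘L
    (U.toContinuousLinearEquiv : L2R →L[ℂ] L2R)) f) : L2R) = M (𝓕 f) :=
    U.apply_symm_apply _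
  rw [h1]
  filter_upwards [(ContinuousLinearMap.mul ℂ ℂ).coeFn_holder (r := 2) (hm.toLp m) (𝓕 f : L2R),
    hm.coeFn_toLp] with ξ h2 h3
  have : M (𝓕 f) = (ContinuousLinearMap.mul ℂ ℂ).holder 2 (hm.toLp m) (𝓕 f : L2R) := rfl
  rw [this, h2, h3]
  rfl

/-- The function `ξ ↦ m(2πξ)` cut off to the frequency band `[-R, R]`. -/
noncomputable def bandSymbol (m : C(ℝ, ℂ)) (R : ℝ) : ℝ → ℂ :=
  (Set.Icc (-R) R).indicator fun ξ => m (2 * Real.pi * ξ)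

theorem memLp_bandSymbol (m : C(ℝ, ℂ)) (R : ℝ) : MemLp (bandSymbol m R) ∞ volume := by
  have hc : Continuous fun ξ : ℝ => m (2 * Real.pi * ξ) := by fun_prop
  obtain ⟨c, hc'⟩ := (isCompact_Icc (a := -R) (b := R)).exists_bound_of_continuousOn hc.continuousOn
  refine memLp_top_of_bound (hc.aestronglyMeasurable.indicator measurableSet_Icc) (max c 0)
    (ae_of_all _ fun ξ => ?_)
  by_cases h : ξ ∈ Set.Icc (-R) R
  · rw [bandSymbol, Set.indicator_of_mem h]
    exact (hc' ξ h).trans (le_max_left _ _)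
  · rw [bandSymbol, Set.indicator_of_notMem h, norm_zero]
    exact le_max_right _ _

/-- The Fourier multiplier with symbol `m`, restricted to frequencies in the band `[-R, R]`. -/
noncomputable def band (R : ℝ) (m : C(ℝ, ℂ)) : L2R →L[ℂ] L2R :=
  (exists_fourier_multiplier _ (memLp_bandSymbol m R)).choose

theorem fourier_band (R : ℝ) (m : C(ℝ, ℂ)) (f : L2R) :
    (𝓕 (band R m f) : L2R) =ᵐ[volume] fun ξ => bandSymbol m R ξ * (𝓕 f : L2R) ξ :=
  (exists_fourier_multiplier _ (memLp_bandSymbol m R)).choose_spec f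

theorem fourier_injective {f g : L2R} (h : (𝓕 f : L2R) =ᵐ[volume] (𝓕 g : L2R)) : f = g :=
  (Lp.fourierTransformₗᵢ ℝ ℂ).injective (Lp.ext h)

theorem fourier_add_ae (f g : L2R) :
    (𝓕 (f + g) : L2R) =ᵐ[volume] fun ξ => (𝓕 f : L2R) ξ + (𝓕 g : L2R) ξ := by
  rw [FourierTransform.fourier_add]
  exact Lp.coeFn_add _ _

variable (R : ℝ) (m n : C(ℝ, ℂ))

theorem band_mul : band R (m * n) = band R m ∘L band R n := by
  ext1 f
  apply fourier_injective
  filter_upwards [fourier_band R (m * n) f, fourier_band R m (band R n f), fourier_band R n f]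
    with ξ h1 h2 h3
  rw [h1, ContinuousLinearMap.comp_apply, h2, h3]
  by_cases h : ξ ∈ Set.Icc (-R) R <;> simp [bandSymbol, h, mul_assoc]

theorem band_mul_apply (f : L2R) : band R (m * n) f = band R m (band R n f) := by
  rw [band_mul]; rfl

theorem band_add : band R (m + n) = band R m + band R n := by
  ext1 f
  apply fourier_injective
  rw [add_apply]
  filter_upwards [fourier_band R (m + n) f, fourier_band R m f, fourier_band R n f,
    fourier_add_ae (band R m f) (band R n f)] with ξ h1 h2 h3 h4
  rw [h1, h4, h2, h3]
  by_cases h : ξ ∈ Set.Icc (-R) R <;> simp [bandSymbol, h, add_mul]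

theorem band_zero : band R 0 = 0 := by
  have := band_add R 0 0
  simpa using this

theorem band_neg : band R (-m) = -band R m := by
  rw [eq_neg_iff_add_eq_zero, ← band_add, neg_add_cancel, band_zero]

theorem band_sub : band R (m - n) = band R m - band R n := by
  rw [sub_eq_add_neg, band_add, band_neg, sub_eq_add_neg]

theorem inner_eq_integral_fourier (f g : L2R) :
    inner ℂ f g = ∫ ξ : ℝ, (𝓕 g : L2R) ξ * conj ((𝓕 f : L2R) ξ) := by
  rw [← Lp.inner_fourier_eq, L2.inner_def]
  rfl

theorem adjoint_band : ContinuousLinearMap.adjoint (band R m) = band R (star m) := by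
  symm
  rw [ContinuousLinearMap.eq_adjoint_iff]
  intro f g
  rw [inner_eq_integral_fourier, inner_eq_integral_fourier]
  apply integral_congr_ae
  filter_upwards [fourier_band R m g, fourier_band R (star m) f] with ξ h1 h2
  rw [h1, h2]
  by_cases h : ξ ∈ Set.Icc (-R) R <;> simp [bandSymbol, h]
  ring

/-- A bounded operator with continuous Fourier symbol acts on band-limited functions as a
multiplier. -/
theorem comp_band {T : L2R →L[ℂ] L2R} (hT : HasBoundedFourierSymbol T m) :
    T ∘L band R n = band R (m * n) := by
  ext1 f
  apply fourier_injective
  filter_upwards [fourier_band R (m * n) f, hT (band R n f), fourier_band R n f] with ξ h1 h2 h3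
  rw [h1, ContinuousLinearMap.comp_apply, h2, h3]
  by_cases h : ξ ∈ Set.Icc (-R) R <;> simp [bandSymbol, h, mul_assoc]

/-- The Fourier symbol of a bounded operator can be read off from its low-frequency parts. -/
theorem hasBoundedFourierSymbol_of_band {T : L2R →L[ℂ] L2R}
    (h : ∀ R : ℝ, band R 1 ∘L T = band R m) : HasBoundedFourierSymbol T m := by
  intro f
  -- Integer bands suffice: they cost countably many null sets and cover every frequency.
  have key : ∀ᵐ ξ : ℝ, ∀ k : ℕ, bandSymbol 1 k ξ * (𝓕 (T f) : L2R) ξ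
      = bandSymbol m k ξ * (𝓕 f : L2R) ξ := by
    rw [ae_all_iff]
    intro k
    have h1 : band k 1 (T f) = band k m f := by rw [← h]; rfl
    filter_upwards [fourier_band k 1 (T f), fourier_band k m f] with ξ h2 h3
    rw [← h2, h1, h3]
  filter_upwards [key] with ξ hξ
  obtain ⟨k, hk⟩ := exists_nat_ge |ξ|
  have hmem : ξ ∈ Set.Icc (-(k : ℝ)) k := abs_le.mp hk
  simpa [bandSymbol, hmem] using hξ k

/-- Taking adjoints in `T ∘ band 1 = band m` puts the band projection on the left of `T*`, the form
from which a symbol can be read off. -/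
theorem hasBoundedFourierSymbol_adjoint {T : L2R →L[ℂ] L2R} (hT : HasBoundedFourierSymbol T m) :
    HasBoundedFourierSymbol (ContinuousLinearMap.adjoint T) (star m : C(ℝ, ℂ)) := by
  apply hasBoundedFourierSymbol_of_band
  intro R
  have := congrArg ContinuousLinearMap.adjoint (comp_band R m 1 hT)
  rw [ContinuousLinearMap.adjoint_comp, adjoint_band, adjoint_band] at this
  simpa using this

theorem hasBoundedFourierSymbol_comp {T T' : L2R →L[ℂ] L2R} (hT : HasBoundedFourierSymbol T m)
    (hT' : HasBoundedFourierSymbol T' n) : HasBoundedFourierSymbol (T ∘L T') (m * n : C(ℝ, ℂ)) := by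
  intro f
  filter_upwards [hT (T' f), hT' f] with ξ h1 h2
  rw [ContinuousLinearMap.comp_apply, h1, h2]
  simp [mul_assoc]

theorem injective_of_symbol_ne_zero {T : L2R →L[ℂ] L2R} (hT : HasBoundedFourierSymbol T m)
    (hm : ∀ lam, m lam ≠ 0) : Function.Injective T := by
  intro f g hfg
  apply fourier_injective
  filter_upwards [hT f, hT g] with ξ h1 h2
  rw [hfg, h2] at h1
  exact (mul_left_cancel₀ (hm _) h1).symm

end BandMultiplier

/-! ### Orbits of a semigroup and the domain of its generator -/

namespace C0Semigroup

variable {X : Type*} [NormedAddCommGroup X] [NormedSpace ℂ X]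

/-- The orbits of a semigroup, extended by a constant to negative times. -/
def orbit (V : C0Semigroup X) (x : X) (t : ℝ) : X := V.op t.toNNReal x

theorem orbit_zero (V : C0Semigroup X) (x : X) : V.orbit x 0 = x := by
  simp [orbit, V.op_zero]

theorem orbit_add (V : C0Semigroup X) (x : X) {s t : ℝ} (hs : 0 ≤ s) (ht : 0 ≤ t) :
    V.orbit x (s + t) = V.op s.toNNReal (V.orbit x t) := by
  rw [orbit, Real.toNNReal_add hs ht, V.op_add]; rfl

theorem IsExponentiallyStable.exists_norm_le {V : C0Semigroup X} (hV : V.IsExponentiallyStable) :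
    ∃ M : ℝ, 0 ≤ M ∧ ∀ t, ‖V.op t‖ ≤ M := by
  obtain ⟨M, ω, hω, h⟩ := hV
  have hM : 0 ≤ M := by
    have := (norm_nonneg _).trans (h 0)
    simpa using this
  refine ⟨M, hM, fun t => (h t).trans ?_⟩
  refine mul_le_of_le_one_right hM (Real.exp_le_one_iff.mpr ?_)
  have := t.coe_nonneg
  nlinarith

theorem IsExponentiallyStable.tendsto_orbit {V : C0Semigroup X} (hV : V.IsExponentiallyStable)
    (x : X) : Tendsto (V.orbit x) atTop (𝓝 0) := by
  obtain ⟨M, ω, hω, h⟩ := hV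
  have h1 : Tendsto (fun t : ℝ => M * Real.exp (-ω * t) * ‖x‖) atTop (𝓝 (M * 0 * ‖x‖)) := by
    refine (Tendsto.const_mul M ?_).mul_const _
    exact Real.tendsto_exp_atBot.comp (tendsto_id.const_mul_atTop_of_neg (by linarith))
  rw [mul_zero, zero_mul] at h1
  refine squeeze_zero_norm' ?_ h1
  filter_upwards [eventually_ge_atTop 0] with t ht
  have := (V.op t.toNNReal).le_of_opNorm_le (h t.toNNReal) x
  rwa [Real.coe_toNNReal _ ht] at this

theorem tendsto_coe_nhdsGT_zero : Tendsto Real.toNNReal (𝓝[>] 0) (𝓝[>] 0) := by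
  refine tendsto_nhdsWithin_iff.mpr ⟨?_, ?_⟩
  · have := (continuous_real_toNNReal.tendsto 0).mono_left (nhdsWithin_le_nhds (s := Set.Ioi (0:ℝ)))
    simpa using this
  · filter_upwards [self_mem_nhdsWithin] with t ht
    exact Real.toNNReal_pos.mpr ht

theorem tendsto_orbit_zero (V : C0Semigroup X) (x : X) :
    Tendsto (V.orbit x) (𝓝[>] 0) (𝓝 x) :=
  (V.tendsto_op x).comp tendsto_coe_nhdsGT_zero

/-- The orbits of a uniformly bounded semigroup are continuous. -/
theorem continuous_orbit {V : C0Semigroup X} {M : ℝ} (hM : ∀ t, ‖V.op t‖ ≤ M) (x : X) :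
    Continuous (V.orbit x) := by
  have h0 : Tendsto (fun s : ℝ => ‖V.orbit x |s| - x‖) (𝓝 0) (𝓝 0) := by
    have h : Tendsto (fun s : ℝ => ‖V.orbit x |s| - x‖) (𝓝[≠] 0 ⊔ pure 0) (𝓝 0) := by
      refine tendsto_sup.mpr ⟨?_, ?_⟩
      · have h1 : Tendsto (fun s : ℝ => |s|) (𝓝[≠] 0) (𝓝[>] 0) := tendsto_abs_nhdsNE_zero
        have h2 := ((V.tendsto_orbit_zero x).comp h1).sub_const x
        simpa using h2.norm
      · rw [tendsto_pure_left]
        intro s hs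
        simpa [orbit_zero] using mem_of_mem_nhds hs
    rwa [nhdsNE_sup_pure] at h
  have hM0 : 0 ≤ M := (norm_nonneg _).trans (hM 0)
  -- Factoring out `V(s)` at the earlier time reduces everything to continuity at time zero. By the
  -- uniform bound the estimate is symmetric in the two times, so it gives left continuity too.
  have key : ∀ s t : ℝ, 0 ≤ s → s ≤ t →
      ‖V.orbit x t - V.orbit x s‖ ≤ M * ‖V.orbit x |t - s| - x‖ := by
    intro s t hs hst
    have h1 : V.orbit x t = V.op s.toNNReal (V.orbit x (t - s)) := by
      rw [← V.orbit_add x hs (sub_nonneg.mpr hst)]; ring_nf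
    have h2 : V.orbit x t - V.orbit x s = V.op s.toNNReal (V.orbit x (t - s) - x) := by
      rw [map_sub, ← h1]; rfl
    rw [h2, abs_of_nonneg (sub_nonneg.mpr hst)]
    exact (V.op _).le_of_opNorm_le (hM _) _
  have hcont : ContinuousOn (V.orbit x) (Set.Ici 0) := by
    intro s hs
    rw [ContinuousWithinAt, tendsto_iff_norm_sub_tendsto_zero]
    have h3 : Tendsto (fun t : ℝ => M * ‖V.orbit x |t - s| - x‖) (𝓝[Set.Ici 0] s) (𝓝 0) := by
      have h4 : Tendsto (fun t : ℝ => t - s) (𝓝[Set.Ici 0] s) (𝓝 0) := by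
        have : Tendsto (fun t : ℝ => t - s) (𝓝 s) (𝓝 (s - s)) := tendsto_id.sub_const s
        rw [sub_self] at this
        exact this.mono_left nhdsWithin_le_nhds
      simpa using (h0.comp h4).const_mul M
    refine squeeze_zero' (Eventually.of_forall fun _ => norm_nonneg _) ?_ h3
    filter_upwards [self_mem_nhdsWithin] with t ht
    rcases le_total s t with h | h
    · exact key s t hs h
    · rw [norm_sub_rev, abs_sub_comm]
      exact key t s ht h
  have h5 : V.orbit x = fun t => V.orbit x (max t 0) := by
    funext t
    simp only [orbit]
    congr 2
    rcases le_total t 0 with h | h <;> simp [h, Real.toNNReal_of_nonpos]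
  rw [h5]
  exact hcont.comp_continuous (by fun_prop) fun t => Set.mem_Ici.mpr (le_max_right _ _)

theorem IsGenerator.orbit_mem {V : C0Semigroup X} {A : X →ₗ.[ℂ] X} (hA : V.IsGenerator A)
    {x y : X} (h : (x, y) ∈ A.graph) (t : ℝ) : (V.orbit x t, V.orbit y t) ∈ A.graph := by
  rw [hA] at h ⊢
  refine (((V.op t.toNNReal).continuous.tendsto y).comp h).congr fun s => ?_
  simp only [Function.comp_apply, map_smul, map_sub, orbit]
  rw [← ContinuousLinearMap.comp_apply, ← V.op_add, add_comm, V.op_add]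
  rfl

/-- By the semigroup law, the right difference quotient at `t` is the one at zero for the orbit
started at `V(t) x`. A right derivative is enough to prove constancy later. -/
theorem IsGenerator.hasDerivWithinAt_orbit {V : C0Semigroup X} {A : X →ₗ.[ℂ] X}
    (hA : V.IsGenerator A) {x y : X} (h : (x, y) ∈ A.graph) {t : ℝ} (ht : 0 ≤ t) :
    HasDerivWithinAt (V.orbit x) (V.orbit y t) (Set.Ici t) t := by
  have h1 := (hA _ _).mp (hA.orbit_mem h t)
  have h2 := h1.comp tendsto_coe_nhdsGT_zero
  rw [← hasDerivWithinAt_Ioi_iff_Ici, hasDerivWithinAt_iff_tendsto_slope' (by simp)]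
  have h3 : Tendsto (fun s : ℝ => s - t) (𝓝[>] t) (𝓝[>] 0) := by
    refine tendsto_nhdsWithin_iff.mpr ⟨?_, ?_⟩
    · have : Tendsto (fun s : ℝ => s - t) (𝓝 t) (𝓝 (t - t)) := tendsto_id.sub_const t
      rw [sub_self] at this
      exact this.mono_left nhdsWithin_le_nhds
    · filter_upwards [self_mem_nhdsWithin] with s hs
      exact sub_pos.mpr (Set.mem_Ioi.mp hs)
  refine (h2.comp h3).congr' ?_
  filter_upwards [self_mem_nhdsWithin] with s hs
  have hs' : 0 ≤ s - t := (sub_pos.mpr (Set.mem_Ioi.mp hs)).le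
  simp only [Function.comp_apply, slope_def_module, Real.coe_toNNReal _ hs']
  rw [← V.orbit_add x hs' ht, sub_add_cancel, ← Complex.ofReal_inv, Complex.coe_smul]

/-- The generator of a uniformly bounded semigroup is densely defined. -/
theorem IsGenerator.dense_domain [CompleteSpace X] {V : C0Semigroup X} {A : X →ₗ.[ℂ] X}
    (hA : V.IsGenerator A) {M : ℝ} (hM : ∀ t, ‖V.op t‖ ≤ M) : Dense (A.domain : Set X) := by
  intro x
  have hc := continuous_orbit hM x
  -- The averages `t⁻¹ I(t)` lie in the domain and converge to `x`: applying `V(s)` shifts the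
  -- window of integration, so the difference quotient of `I(t)` is a slope of `s ↦ I(t+s) - I(s)`.
  let I : ℝ → X := fun t => ∫ s in (0 : ℝ)..t, V.orbit x s
  have hI : ∀ t, HasDerivAt I (V.orbit x t) t := fun t =>
    intervalIntegral.integral_hasDerivAt_right (hc.intervalIntegrable _ _)
      hc.stronglyMeasurable.stronglyMeasurableAtFilter hc.continuousAt
  have hI0 : I 0 = 0 := intervalIntegral.integral_same
  have hmem : ∀ t : ℝ, 0 ≤ t → (I t, V.orbit x t - x) ∈ A.graph := by
    intro t ht
    rw [hA]
    have hshift : ∀ s : ℝ≥0, V.op s (I t) = I (t + s) - I s := by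
      intro s
      have h1 : V.op s (I t) = ∫ r in (0 : ℝ)..t, V.op s (V.orbit x r) :=
        ((V.op s).intervalIntegral_comp_comm (hc.intervalIntegrable _ _)).symm
      have h2 : ∫ r in (0 : ℝ)..t, V.op s (V.orbit x r) = ∫ r in (0 : ℝ)..t, V.orbit x (r + s) := by
        apply intervalIntegral.integral_congr
        intro r hr
        rw [Set.uIcc_of_le ht] at hr
        simp only
        rw [add_comm, V.orbit_add x s.coe_nonneg hr.1, Real.toNNReal_coe]
      rw [h1, h2, intervalIntegral.integral_comp_add_right, zero_add]
      exact (intervalIntegral.integral_interval_sub_left (hc.intervalIntegrable _ _)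
        (hc.intervalIntegrable _ _)).symm
    have h3 : HasDerivAt (fun s : ℝ => I (t + s) - I s) (V.orbit x t - x) 0 := by
      have h4 : HasDerivAt (fun s : ℝ => I (t + s)) (V.orbit x t) 0 := by
        have := (hI (t + 0)).comp_const_add t 0
        simpa using this
      have := h4.sub (hI 0)
      rwa [V.orbit_zero] at this
    have h5 := (hasDerivAt_iff_tendsto_slope.mp h3)
    have h6 : Tendsto (fun s : ℝ≥0 => (s : ℝ)) (𝓝[>] 0) (𝓝[≠] 0) := by
      refine tendsto_nhdsWithin_iff.mpr ⟨?_, ?_⟩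
      · have := (NNReal.continuous_coe.tendsto 0).mono_left
          (nhdsWithin_le_nhds (s := Set.Ioi (0 : ℝ≥0)))
        simpa using this
      · filter_upwards [self_mem_nhdsWithin] with s hs
        exact (NNReal.coe_pos.mpr hs).ne'
    refine (h5.comp h6).congr fun s => ?_
    simp only [Function.comp_apply, slope_def_module, hshift, hI0, sub_zero, add_zero]
    rw [← Complex.ofReal_inv, Complex.coe_smul]
  have hlim : Tendsto (fun t : ℝ => t⁻¹ • I t) (𝓝[>] 0) (𝓝 x) := by
    have := (hasDerivAt_iff_tendsto_slope.mp (hI 0)).mono_left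
      (nhdsWithin_mono 0 (fun t (ht : 0 < t) => ht.ne'))
    rw [V.orbit_zero] at this
    refine this.congr fun t => ?_
    rw [slope_def_module, hI0, sub_zero, sub_zero]
  refine mem_closure_of_tendsto hlim ?_
  filter_upwards [self_mem_nhdsWithin] with t ht
  have h7 := LinearPMap.mem_domain_of_mem_graph (hmem t (le_of_lt ht))
  rw [← Complex.coe_smul]
  exact A.domain.smul_mem _ h7

end C0Semigroup

/-! ### Graphs of unbounded operators -/

section Graphs

variable {H : Type*} [NormedAddCommGroup H] [InnerProductSpace ℂ H]

theorem inner_of_mem_graph_adjoint [CompleteSpace H] {T : H →ₗ.[ℂ] H}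
    (hT : Dense (T.domain : Set H))
    {x x' v v' : H} (hx : (x, x') ∈ T†.graph) (hv : (v, v') ∈ T.graph) :
    inner ℂ x' v = inner ℂ x v' := by
  obtain ⟨X, hX, hX'⟩ := (LinearPMap.mem_graph_iff _).mp hx
  obtain ⟨V, hV, hV'⟩ := (LinearPMap.mem_graph_iff _).mp hv
  have := LinearPMap.adjoint_isFormalAdjoint hT X V
  simp only at hX hX' hV hV'
  rwa [hX, hX', hV, hV'] at this

theorem mem_graph_adjoint_of_inner [CompleteSpace H] {T : H →ₗ.[ℂ] H}
    (hT : Dense (T.domain : Set H)) {x x' : H}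
    (h : ∀ v v' : H, (v, v') ∈ T.graph → inner ℂ x' v = inner ℂ x v') : (x, x') ∈ T†.graph := by
  have h' : ∀ v : T.domain, inner ℂ x' (v : H) = inner ℂ x (T v) := fun v => h _ _ (T.mem_graph v)
  have hx := LinearPMap.mem_adjoint_domain_of_exists x ⟨x', h'⟩
  exact (LinearPMap.mem_graph_iff _).mpr ⟨⟨x, hx⟩, rfl, LinearPMap.adjoint_apply_eq hT ⟨x, hx⟩ h'⟩

theorem exists_of_mem_graph_sub {T U : H →ₗ.[ℂ] H} {x y : H} (h : (x, y) ∈ (T - U).graph) :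
    ∃ y₁ y₂ : H, (x, y₁) ∈ T.graph ∧ (x, y₂) ∈ U.graph ∧ y = y₁ - y₂ := by
  obtain ⟨X, hX, hX'⟩ := (LinearPMap.mem_graph_iff _).mp h
  simp only at hX hX'
  refine ⟨T ⟨X, X.2.1⟩, U ⟨X, X.2.2⟩, ?_, ?_, ?_⟩
  · exact (LinearPMap.mem_graph_iff _).mpr ⟨⟨X, X.2.1⟩, hX, rfl⟩
  · exact (LinearPMap.mem_graph_iff _).mpr ⟨⟨X, X.2.2⟩, hX, rfl⟩
  · rw [← hX', LinearPMap.sub_apply]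

theorem mem_graph_inverse_toPMap_top {T : H →L[ℂ] H} (hT : Function.Injective T) {f s : H} :
    (f, s) ∈ (LinearPMap.inverse ((T : H →ₗ[ℂ] H).toPMap ⊤)).graph ↔ T s = f := by
  have hker : LinearMap.ker ((T : H →ₗ[ℂ] H).toPMap ⊤).toFun = ⊥ := by
    rw [LinearMap.ker_eq_bot]
    intro s t hst
    exact Subtype.ext (hT hst)
  rw [LinearPMap.inverse_graph hker]
  constructor
  · rintro ⟨⟨u, v⟩, huv, h⟩
    obtain ⟨U, hU, hU'⟩ := (LinearPMap.mem_graph_iff _).mp huv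
    simp only [LinearEquiv.coe_coe, LinearEquiv.prodComm_apply, Prod.swap_prod_mk,
      Prod.mk.injEq] at h hU hU'
    rw [← h.1, ← h.2, ← hU', ← hU]
    rfl
  · rintro rfl
    exact ⟨(s, T s), (LinearPMap.mem_graph_iff _).mpr ⟨⟨s, trivial⟩, rfl, rfl⟩, rfl⟩

theorem mem_graph_compPMap {T : H →ₗ[ℂ] H} {U : H →ₗ.[ℂ] H} {f y : H} :
    (f, y) ∈ (T.compPMap U).graph ↔ ∃ s, (f, s) ∈ U.graph ∧ T s = y := by
  simp only [LinearPMap.mem_graph_iff]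
  constructor
  · rintro ⟨X, hX, hX'⟩
    exact ⟨U X, ⟨X, hX, rfl⟩, hX'⟩
  · rintro ⟨s, ⟨X, hX, hX'⟩, rfl⟩
    exact ⟨X, hX, by rw [← hX']; rfl⟩

end Graphs

theorem mem_graph_kalmanGain {G P : L2R →L[ℂ] L2R}
    (hG : Function.Injective (G ∘L ContinuousLinearMap.adjoint G)) {f y : L2R} :
    (f, y) ∈ (kalmanGain G P).graph ↔
      ∃ s, G (ContinuousLinearMap.adjoint G s) = f ∧ P s = y := by
  rw [kalmanGain, mem_graph_compPMap]
  simp only [noiseCovInv, mem_graph_inverse_toPMap_top hG]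
  rfl

/-- The domain is the range of the self-adjoint operator `G G*`, whose orthogonal complement is the
kernel, trivial by injectivity. -/
theorem dense_domain_kalmanGain {G P : L2R →L[ℂ] L2R}
    (hG : Function.Injective (G ∘L ContinuousLinearMap.adjoint G)) :
    Dense ((kalmanGain G P).domain : Set L2R) := by
  rw [Submodule.dense_iff_topologicalClosure_eq_top, Submodule.topologicalClosure_eq_top_iff,
    Submodule.eq_bot_iff]
  intro v hv
  have h0 : (G ∘L ContinuousLinearMap.adjoint G) v = (G ∘L ContinuousLinearMap.adjoint G) 0 := by
    rw [map_zero]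
    refine ext_inner_left ℂ fun s => ?_
    rw [inner_zero_right, ContinuousLinearMap.comp_apply,
      ← ContinuousLinearMap.adjoint_inner_left, ← ContinuousLinearMap.adjoint_inner_left,
      ContinuousLinearMap.adjoint_adjoint]
    exact hv _ (LinearPMap.mem_domain_of_mem_graph
      ((mem_graph_kalmanGain (P := P) hG).mpr ⟨s, rfl, rfl⟩))
  exact hG h0

/-- This is the inclusion `L* ⊆ (G G*)⁻¹ P`, obtained by testing against `L (G G* s) = P s`. The
reverse inclusion is not needed. -/
theorem apply_eq_of_mem_graph_adjoint_kalmanGain {G P : L2R →L[ℂ] L2R}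
    (hG : Function.Injective (G ∘L ContinuousLinearMap.adjoint G)) (hP : IsSelfAdjoint P)
    {x z : L2R} (h : (x, z) ∈ (kalmanGain G P)†.graph) :
    G (ContinuousLinearMap.adjoint G z) = P x := by
  refine ext_inner_right ℂ fun s => ?_
  have h1 := inner_of_mem_graph_adjoint (dense_domain_kalmanGain hG) h
    ((mem_graph_kalmanGain (P := P) hG).mpr ⟨s, rfl, rfl⟩)
  rw [← ContinuousLinearMap.adjoint_inner_right, ← ContinuousLinearMap.adjoint_inner_right,
    ContinuousLinearMap.adjoint_adjoint, h1, ← ContinuousLinearMap.adjoint_inner_left,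
    hP.adjoint_eq]

/-! ### The symbols as continuous functions -/

namespace PlantSymbols

variable (S : PlantSymbols)

theorem continuous_symbA : Continuous fun lam : ℝ => S.a.eval (lam : ℂ) :=
  S.a.continuous.comp Complex.continuous_ofReal

theorem continuous_symbB : Continuous S.symbB :=
  continuous_const.div (S.pB.continuous.comp Complex.continuous_ofReal) S.pB_ne_zero

theorem continuous_symbG : Continuous S.symbG :=
  continuous_const.div (S.pG.continuous.comp Complex.continuous_ofReal) S.pG_ne_zero

theorem symbG_ne_zero (lam : ℝ) : S.symbG lam ≠ 0 := div_ne_zero S.g_ne_zero (S.pG_ne_zero lam)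

theorem symbB_ne_zero (lam : ℝ) : S.symbB lam ≠ 0 := div_ne_zero S.b_ne_zero (S.pB_ne_zero lam)

theorem continuous_gainSymbol : Continuous S.gainSymbol := by
  have h1 : Continuous fun lam : ℝ => (S.a.eval (lam : ℂ)).re :=
    Complex.continuous_re.comp S.continuous_symbA
  have h2 : Continuous fun lam => S.symbB lam / S.symbG lam :=
    S.continuous_symbB.div S.continuous_symbG S.symbG_ne_zero
  exact h1.add ((h1.pow 2).add (h2.norm.pow 2)).sqrt

/-- The symbol of the plant generator, as a bundled continuous function. -/
def contA : C(ℝ, ℂ) := ⟨fun lam => S.a.eval (lam : ℂ), S.continuous_symbA⟩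

/-- `B^`, as a bundled continuous function. -/
noncomputable def contB : C(ℝ, ℂ) := ⟨S.symbB, S.continuous_symbB⟩

/-- `G^`, as a bundled continuous function. -/
noncomputable def contG : C(ℝ, ℂ) := ⟨S.symbG, S.continuous_symbG⟩

/-- The symbol of the gain, as a bundled continuous function. -/
noncomputable def contGain : C(ℝ, ℂ) :=
  ⟨fun lam => (S.gainSymbol lam : ℂ), Complex.continuous_ofReal.comp S.continuous_gainSymbol⟩

/-- The symbol `|G^|² L^` of the stabilizing solution of the Riccati equation. -/
noncomputable def contP : C(ℝ, ℂ) := S.contG * star S.contG * S.contGain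

/-- The symbol of the adjoint of the closed loop operator. -/
noncomputable def contLoop : C(ℝ, ℂ) := star S.contA - S.contGain

theorem star_contP : star S.contP = S.contP := by
  ext lam
  simp only [contP, contGain, ContinuousMap.star_apply, ContinuousMap.mul_apply,
    ContinuousMap.coe_mk, star_mul', star_star, RCLike.star_def, Complex.conj_ofReal]
  ring

theorem gainSymbol_sq (lam : ℝ) : S.gainSymbol lam ^ 2 =
    2 * (S.a.eval (lam : ℂ)).re * S.gainSymbol lam + ‖S.symbB lam / S.symbG lam‖ ^ 2 := by
  have h : 0 ≤ (S.a.eval (lam : ℂ)).re ^ 2 + ‖S.symbB lam / S.symbG lam‖ ^ 2 := by positivity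
  have := Real.sq_sqrt h
  rw [gainSymbol]
  linear_combination this

/-- The Riccati equation on the level of symbols. -/
theorem riccati_symbol :
    S.contB * star S.contB + S.contP * S.contLoop + S.contA * S.contP = 0 := by
  ext lam
  have h1 := S.gainSymbol_sq lam
  have hG : (S.symbG lam) * conj (S.symbG lam) = ((‖S.symbG lam‖ ^ 2 : ℝ) : ℂ) := by
    rw [Complex.mul_conj']; push_cast; rfl
  have hB : (S.symbB lam) * conj (S.symbB lam) = ((‖S.symbB lam‖ ^ 2 : ℝ) : ℂ) := by
    rw [Complex.mul_conj']; push_cast; rfl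
  have hn : ‖S.symbG lam‖ ≠ 0 := norm_ne_zero_iff.mpr (S.symbG_ne_zero lam)
  have hA : S.a.eval (lam : ℂ) + conj (S.a.eval (lam : ℂ))
      = ((2 * (S.a.eval (lam : ℂ)).re : ℝ) : ℂ) := Complex.add_conj _
  have h2 : ‖S.symbB lam‖ ^ 2 = ‖S.symbG lam‖ ^ 2 *
      (S.gainSymbol lam ^ 2 - 2 * (S.a.eval (lam : ℂ)).re * S.gainSymbol lam) := by
    rw [h1, norm_div]; field_simp; ring
  simp only [contP, contLoop, contA, contB, contG, contGain, ContinuousMap.add_apply,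
    ContinuousMap.mul_apply, ContinuousMap.sub_apply, ContinuousMap.star_apply,
    ContinuousMap.coe_mk, ContinuousMap.zero_apply, RCLike.star_def]
  rw [hB, hG, h2]
  push_cast at hA ⊢
  linear_combination (‖S.symbG lam‖ : ℂ) ^ 2 * (S.gainSymbol lam : ℂ) * hA

/-- The real part is minus the square root of the radicand. No gap below zero is needed: the decay
will come from the closed-loop semigroup. -/
theorem re_contLoop_nonpos (lam : ℝ) : (S.contLoop lam).re ≤ 0 := by
  simp only [contLoop, contA, contGain, ContinuousMap.sub_apply, ContinuousMap.star_apply,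
    ContinuousMap.coe_mk, RCLike.star_def, Complex.sub_re, Complex.conj_re, Complex.ofReal_re,
    gainSymbol]
  have := Real.sqrt_nonneg
    ((S.a.eval (lam : ℂ)).re ^ 2 + ‖S.symbB lam / S.symbG lam‖ ^ 2)
  linarith

end PlantSymbols

/-! ### The plant operators on band-limited functions -/

section Plant

variable {S : PlantSymbols} {A : L2R →ₗ.[ℂ] L2R} {B G P : L2R →L[ℂ] L2R}

theorem band_mem_graph (hA : IsDifferentialOperator A S.a) (R : ℝ) (m : C(ℝ, ℂ)) (f : L2R) :
    (band R m f, band R (S.contA * m) f) ∈ A.graph := by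
  rw [hA]
  filter_upwards [fourier_band R m f, fourier_band R (S.contA * m) f] with ξ h1 h2
  rw [h1, h2]
  by_cases h : ξ ∈ Set.Icc (-R) R <;> simp [bandSymbol, h, mul_assoc, PlantSymbols.contA]

theorem band_mem_graph_adjoint (hA : IsDifferentialOperator A S.a)
    (hd : Dense (A.domain : Set L2R)) (R : ℝ) (m : C(ℝ, ℂ)) (f : L2R) :
    (band R m f, band R (star S.contA * m) f) ∈ A†.graph := by
  refine mem_graph_adjoint_of_inner hd fun v v' hv => ?_
  rw [inner_eq_integral_fourier, inner_eq_integral_fourier]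
  apply integral_congr_ae
  filter_upwards [fourier_band R m f, fourier_band R (star S.contA * m) f, (hA v v').mp hv]
    with ξ h1 h2 h3
  rw [h1, h2, h3]
  by_cases h : ξ ∈ Set.Icc (-R) R <;> simp [bandSymbol, h, PlantSymbols.contA]
  ring

theorem inner_adjoint_adjoint_band (hB : HasBoundedFourierSymbol B S.symbB) (R : ℝ) (y x : L2R) :
    inner ℂ (ContinuousLinearMap.adjoint B (band R 1 y)) (ContinuousLinearMap.adjoint B x)
      = inner ℂ (band R (S.contB * star S.contB) y) x := by
  have h1 := comp_band R S.contB (star S.contB * 1) hB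
  have h2 := comp_band R (star S.contB) 1 (hasBoundedFourierSymbol_adjoint S.contB hB)
  have h3 : band R (S.contB * star S.contB) y = B (ContinuousLinearMap.adjoint B (band R 1 y)) := by
    have h4 : ContinuousLinearMap.adjoint B (band R 1 y) = band R (star S.contB * 1) y :=
      DFunLike.congr_fun h2 y
    have h5 := DFunLike.congr_fun h1 y
    rw [h4, ← ContinuousLinearMap.comp_apply, h5, mul_one]
  rw [h3, ContinuousLinearMap.adjoint_inner_right]

theorem noiseCov_band (hG : HasBoundedFourierSymbol G S.symbG) (R : ℝ) (m : C(ℝ, ℂ)) (y : L2R) :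
    G (ContinuousLinearMap.adjoint G (band R m y)) = band R (S.contG * star S.contG * m) y :=
  DFunLike.congr_fun (comp_band R (S.contG * star S.contG) m
    (hasBoundedFourierSymbol_comp S.contG (star S.contG) hG
      (hasBoundedFourierSymbol_adjoint S.contG hG))) y

theorem injective_noiseCov (hG : HasBoundedFourierSymbol G S.symbG) :
    Function.Injective (G ∘L ContinuousLinearMap.adjoint G) := by
  refine injective_of_symbol_ne_zero (S.contG * star S.contG)
    (hasBoundedFourierSymbol_comp S.contG (star S.contG) hG
      (hasBoundedFourierSymbol_adjoint S.contG hG)) fun lam => ?_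
  simpa [PlantSymbols.contG] using S.symbG_ne_zero lam

/-- The difference `D` of a solution `P` of the Riccati equation and the multiplier by the symbol
`|G^|² L^` satisfies a homogeneous Sylvester equation. -/
theorem sylvester_eq_zero (hd : Dense (A.domain : Set L2R)) (hA : IsDifferentialOperator A S.a)
    (hB : HasBoundedFourierSymbol B S.symbB) (hG : HasBoundedFourierSymbol G S.symbG)
    (hP : IsSelfAdjoint P) (hric : SatisfiesRiccati A B G P) (R : ℝ) {y : L2R}
    (hy : band R 1 y = y) {x x' z : L2R} (hx : (x, x') ∈ A†.graph)
    (hz : G (ContinuousLinearMap.adjoint G z) = P x) :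
    inner ℂ (P y - band R S.contP y) (x' - z) +
      inner ℂ (P (band R S.contLoop y) - band R S.contP (band R S.contLoop y)) x = 0 := by
  have hsymm : ∀ u v : L2R, inner ℂ (P u) v = inner ℂ u (P v) := fun u v => by
    conv_lhs => rw [← hP.adjoint_eq]
    rw [ContinuousLinearMap.adjoint_inner_left]
  have hyA : (y, band R (star S.contA) y) ∈ A†.graph := by
    have := band_mem_graph_adjoint hA hd R 1 y
    rwa [hy, mul_one] at this
  -- The equation is tested with `h = x`, `f = y`. Injectivity of `G` forces `G⁻¹ P x = G* z`, so
  -- the quadratic term becomes `⟨P y, z⟩`.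
  have ric : inner ℂ (P (band R (star S.contA) y)) x + inner ℂ (P y) x' +
      inner ℂ (band R (S.contB * star S.contB) y) x - inner ℂ (P y) z = 0 := by
    obtain ⟨u, w, hu, hw, h⟩ := hric x x' y _ hx hyA
    have hu' : u = ContinuousLinearMap.adjoint G z :=
      injective_of_symbol_ne_zero S.contG hG S.symbG_ne_zero (hu.trans hz.symm)
    rw [hu', ContinuousLinearMap.adjoint_inner_right G, hw, ← hsymm] at h
    rw [← inner_adjoint_adjoint_band hB, hy]
    exact h
  -- Since `P x = G G* z`, moving `G G*` to the left factor multiplies the symbol `ℓ` by `|G^|²`.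
  have hgain : inner ℂ (P (band R S.contGain y)) x = inner ℂ (band R S.contP y) z := by
    rw [hsymm, ← hz, ← ContinuousLinearMap.adjoint_inner_left,
      ← ContinuousLinearMap.adjoint_inner_left, ContinuousLinearMap.adjoint_adjoint,
      noiseCov_band hG]
    rfl
  have hadj : inner ℂ (band R S.contP y) x' = inner ℂ (band R (S.contA * S.contP) y) x := by
    rw [← inner_conj_symm, inner_of_mem_graph_adjoint hd hx (band_mem_graph hA R S.contP y),
      inner_conj_symm]
  have hsym : inner ℂ (band R (S.contB * star S.contB) y) x +
      inner ℂ (band R (S.contP * S.contLoop) y) x +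
      inner ℂ (band R (S.contA * S.contP) y) x = 0 := by
    rw [← inner_add_left, ← inner_add_left, ← add_apply, ← add_apply, ← band_add, ← band_add,
      S.riccati_symbol, band_zero, zero_apply, inner_zero_left]
  have hloop : P (band R S.contLoop y) = P (band R (star S.contA) y) - P (band R S.contGain y) := by
    rw [PlantSymbols.contLoop, band_sub, sub_apply, map_sub]
  rw [← band_mul_apply, hloop]
  simp only [inner_sub_left, inner_sub_right]
  linear_combination ric - hgain - hadj - hsym

theorem re_inner_band_nonpos (R : ℝ) {m : C(ℝ, ℂ)} (hm : ∀ lam, (m lam).re ≤ 0) (u : L2R) :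
    (inner ℂ u (band R m u)).re ≤ 0 := by
  rw [inner_eq_integral_fourier]
  set F : ℝ → ℂ := fun ξ => (𝓕 (band R m u) : L2R) ξ * conj ((𝓕 u : L2R) ξ)
  -- Otherwise the Bochner integral is zero by convention, so integrability need not be proved.
  by_cases hF : Integrable F
  · have h1 : (∫ ξ, F ξ).re = ∫ ξ, (F ξ).re := (Complex.reCLM.integral_comp_comm hF).symm
    rw [h1]
    apply integral_nonpos_of_ae
    filter_upwards [fourier_band R m u] with ξ h2
    simp only [F, h2, mul_assoc, Complex.mul_conj', Pi.zero_apply]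
    rw [← Complex.ofReal_pow, Complex.re_mul_ofReal]
    refine mul_nonpos_of_nonpos_of_nonneg ?_ (sq_nonneg _)
    by_cases h : ξ ∈ Set.Icc (-R) R <;> simp [bandSymbol, h, hm]
  · rw [integral_undef hF, Complex.zero_re]

/-- The multiplier semigroup generated by a symbol with nonpositive real part is contractive. -/
theorem exists_band_flow (R : ℝ) (m : C(ℝ, ℂ)) (hm : ∀ lam, (m lam).re ≤ 0) (f : L2R) :
    ∃ y : ℝ → L2R, y 0 = band R 1 f ∧ (∀ t, band R 1 (y t) = y t) ∧
      (∀ t, HasDerivAt y (band R m (y t)) t) ∧ ∀ t, 0 ≤ t → ‖y t‖ ≤ ‖band R 1 f‖ := by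
  -- The band-limited generator is bounded, so the flow is an operator exponential and is
  -- differentiable at every vector.
  let E : ℝ → (L2R →L[ℂ] L2R) := fun t => NormedSpace.exp ((t : ℂ) • band R m)
  have hE : ∀ t, HasDerivAt E (band R m * E t) t := by
    intro t
    have := (hasDerivAt_exp_smul_const' (𝕂 := ℂ) (band R m) (t : ℂ)).scomp t
      Complex.ofRealCLM.hasDerivAt
    simp only [Complex.ofRealCLM_apply, Complex.ofReal_one, one_smul] at this
    exact this
  have hy : ∀ t, HasDerivAt (fun t => E t (band R 1 f)) (band R m (E t (band R 1 f))) t := by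
    intro t
    have := ((ContinuousLinearMap.apply ℂ L2R (band R 1 f)).restrictScalars ℝ).hasFDerivAt
      |>.comp_hasDerivAt t (hE t)
    exact this
  have h0 : E 0 (band R 1 f) = band R 1 f := by
    change NormedSpace.exp (((0 : ℝ) : ℂ) • band R m) (band R 1 f) = _
    rw [Complex.ofReal_zero, zero_smul, NormedSpace.exp_zero]
    rfl
  refine ⟨fun t => E t (band R 1 f), h0, fun t => ?_, hy, fun t ht => ?_⟩
  · have hc : Commute (band R 1) (E t) := by
      apply Commute.exp_right
      apply Commute.smul_right
      change band R 1 ∘L band R m = band R m ∘L band R 1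
      rw [← band_mul, ← band_mul, mul_comm]
    have h1 : band R 1 (E t (band R 1 f)) = E t (band R 1 (band R 1 f)) :=
      DFunLike.congr_fun hc.eq _
    rw [h1, ← band_mul_apply, mul_one]
  · have hn : ∀ t, HasDerivAt (fun t => ‖E t (band R 1 f)‖ ^ 2)
        (2 * (inner ℂ (E t (band R 1 f)) (band R m (E t (band R 1 f)))).re) t := by
      intro t
      have h1 := (Complex.reCLM.hasFDerivAt).comp_hasDerivAt t ((hy t).inner ℂ (hy t))
      have h2 : ∀ u v : L2R, (inner ℂ v u : ℂ).re = (inner ℂ u v : ℂ).re := fun u v => by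
        rw [← inner_conj_symm, Complex.conj_re]
      convert! h1 using 1
      · funext s
        exact (inner_self_eq_norm_sq (𝕜 := ℂ) _).symm
      · rw [Complex.reCLM_apply, Complex.add_re, h2 (E t (band R 1 f))]
        ring
    have hanti : Antitone fun t => ‖E t (band R 1 f)‖ ^ 2 := by
      refine antitone_of_deriv_nonpos (fun t => (hn t).differentiableAt) fun t => ?_
      rw [(hn t).deriv]
      linarith [re_inner_band_nonpos R hm (E t (band R 1 f))]
    have h2 := hanti ht
    simp only [h0] at h2
    exact (sq_le_sq₀ (norm_nonneg _) (norm_nonneg _)).mp h2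

/-- A stabilizing solution of the Riccati equation acts on band-limited functions as the multiplier
with symbol `|G^|² L^`. -/
theorem apply_band_of_stabilizing (hd : Dense (A.domain : Set L2R))
    (hA : IsDifferentialOperator A S.a) (hB : HasBoundedFourierSymbol B S.symbB)
    (hG : HasBoundedFourierSymbol G S.symbG) (hP : IsStabilizingSolution A B G P) (R : ℝ) :
    P ∘L band R 1 = band R S.contP := by
  obtain ⟨V, hgen, hst⟩ := hP.stabilizing
  obtain ⟨M, hM0, hM⟩ := hst.exists_norm_le
  ext1 f
  obtain ⟨y, hy0, hyband, hy, hynorm⟩ := exists_band_flow R S.contLoop S.re_contLoop_nonpos f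
  let D : L2R →L[ℂ] L2R := P - band R S.contP
  suffices h : D (band R 1 f) = 0 by
    rw [sub_apply, sub_eq_zero, ← band_mul_apply, mul_one] at h
    exact h
  refine (hgen.dense_domain hM).eq_zero_of_inner_left ℂ fun h hh => ?_
  obtain ⟨h', hh'⟩ : ∃ h', (h, h') ∈ (A† - (kalmanGain G P)†).graph :=
    ⟨_, LinearPMap.mem_graph _ ⟨h, hh⟩⟩
  -- Its right derivative is exactly the left side of the Sylvester equation, hence zero. As `y`
  -- stays bounded and the orbit tends to zero, the constant value `⟨D (band 1 f), h⟩` is zero.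
  let φ : ℝ → ℂ := fun t => inner ℂ (D (y t)) (V.orbit h t)
  have hDy : ∀ t, HasDerivAt (fun t => D (y t)) (D (band R S.contLoop (y t))) t := fun t =>
    (D.restrictScalars ℝ).hasFDerivAt.comp_hasDerivAt t (hy t)
  have hderiv : ∀ t, 0 ≤ t → HasDerivWithinAt φ 0 (Set.Ici t) t := by
    intro t ht
    have h1 := (hDy t).hasDerivWithinAt.inner ℂ (hgen.hasDerivWithinAt_orbit hh' ht)
    obtain ⟨x', z, hx', hz, hxz⟩ := exists_of_mem_graph_sub (hgen.orbit_mem hh' t)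
    have hz' := apply_eq_of_mem_graph_adjoint_kalmanGain (injective_noiseCov hG) hP.selfAdjoint hz
    rw [hxz] at h1
    have h2 := sylvester_eq_zero hd hA hB hG hP.selfAdjoint hP.riccati R (hyband t) hx' hz'
    simp only [D, sub_apply] at h1 ⊢
    rw [h2] at h1
    exact h1
  have hcont : Continuous φ :=
    (continuous_iff_continuousAt.mpr fun t => (hDy t).continuousAt).inner
      (C0Semigroup.continuous_orbit hM h)
  have hconst : ∀ t, 0 ≤ t → φ t = φ 0 := fun t ht =>
    constant_of_has_deriv_right_zero hcont.continuousOn (fun s hs => hderiv s hs.1) t ⟨ht, le_rfl⟩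
  have hlim : Tendsto φ atTop (𝓝 0) := by
    have h1 : Tendsto (fun t => ‖D‖ * ‖band R 1 f‖ * ‖V.orbit h t‖) atTop (𝓝 0) := by
      simpa using (hst.tendsto_orbit h).norm.const_mul (‖D‖ * ‖band R 1 f‖)
    refine squeeze_zero_norm' ?_ h1
    filter_upwards [eventually_ge_atTop 0] with t ht
    refine (norm_inner_le_norm _ _).trans ?_
    gcongr
    exact D.le_of_opNorm_le_of_le le_rfl (hynorm t ht)
  have hφ : φ 0 = 0 := tendsto_nhds_unique
    (tendsto_const_nhds.congr' (by
      filter_upwards [eventually_ge_atTop 0] with t ht using (hconst t ht).symm)) hlim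
  simpa [φ, hy0, V.orbit_zero] using hφ

/-- A stabilizing solution of the Riccati equation is spatially invariant, with Fourier symbol
`|G^|² L^`. -/
theorem hasBoundedFourierSymbol_of_stabilizing (hd : Dense (A.domain : Set L2R))
    (hA : IsDifferentialOperator A S.a) (hB : HasBoundedFourierSymbol B S.symbB)
    (hG : HasBoundedFourierSymbol G S.symbG) (hP : IsStabilizingSolution A B G P) :
    HasBoundedFourierSymbol P S.contP := by
  refine hasBoundedFourierSymbol_of_band _ fun R => ?_
  -- Self-adjointness of `P` and realness of its candidate symbol move the band projection to the
  -- left.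
  have := congrArg ContinuousLinearMap.adjoint (apply_band_of_stabilizing hd hA hB hG hP R)
  rw [ContinuousLinearMap.adjoint_comp, adjoint_band, adjoint_band, S.star_contP, star_one,
    hP.selfAdjoint.adjoint_eq] at this
  exact this

/-- For `f = G G* s` and `y = P s` one has `f^ = |G^|² s^` and `y^ = |G^|² ℓ s^`, hence `y^ = ℓ f^`.
-/
theorem hasFourierSymbol_kalmanGain (hG : HasBoundedFourierSymbol G S.symbG)
    (hP : HasBoundedFourierSymbol P S.contP) :
    HasFourierSymbol (kalmanGain G P) (fun lam => (S.gainSymbol lam : ℂ)) := by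
  intro f y hfy
  obtain ⟨s, rfl, rfl⟩ := (mem_graph_kalmanGain (injective_noiseCov hG)).mp hfy
  filter_upwards [hP s, hasBoundedFourierSymbol_comp S.contG (star S.contG) hG
    (hasBoundedFourierSymbol_adjoint S.contG hG) s] with ξ h1 h2
  rw [ContinuousLinearMap.comp_apply] at h2
  rw [h1, h2]
  simp only [PlantSymbols.contP, PlantSymbols.contGain, ContinuousMap.mul_apply,
    ContinuousMap.coe_mk]
  ring

end Plant

/-! ### Polynomials without zeros in a vertical strip -/

section Strip

/-- The strip `|Re z| < θ`. -/
def vstrip (θ : ℝ≥0∞) : Set ℂ := {z | ENNReal.ofReal |z.re| < θ}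

theorem abs_re_lt_of_mem_vstrip {θ : ℝ≥0∞} {z r : ℂ} (hz : z ∈ vstrip θ)
    (hr : θ ≤ ENNReal.ofReal |r.re|) : |z.re| < |r.re| :=
  (ENNReal.ofReal_lt_ofReal_iff_of_nonneg (abs_nonneg _)).mp (lt_of_lt_of_le hz hr)

/-- The strip lies on one side of the vertical line through `r`, so `z - r` or `r - z` has positive
real part and the principal root applies; in the second case a factor `i` corrects the sign. -/
theorem exists_analytic_sqrt_sub {θ : ℝ≥0∞} {r : ℂ} (hr : θ ≤ ENNReal.ofReal |r.re|) :
    ∃ s : ℂ → ℂ, AnalyticOnNhd ℂ s (vstrip θ) ∧ ∀ z ∈ vstrip θ, s z ^ 2 = z - r := by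
  have hsq : ∀ w : ℂ, (w ^ (1 / 2 : ℂ)) ^ 2 = w := fun w => by
    have := Complex.cpow_nat_inv_pow w two_ne_zero
    rwa [one_div]
  rcases le_total 0 r.re with h | h
  · refine ⟨fun z => Complex.I * (r - z) ^ (1 / 2 : ℂ), fun z hz => ?_, fun z _ => ?_⟩
    · refine analyticAt_const.mul ((analyticAt_const.sub analyticAt_id).cpow analyticAt_const ?_)
      left
      have h1 := abs_re_lt_of_mem_vstrip hz hr
      rw [abs_of_nonneg h] at h1
      simpa using (le_abs_self _).trans_lt h1
    · rw [mul_pow, hsq, Complex.I_sq]; ring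
  · refine ⟨fun z => (z - r) ^ (1 / 2 : ℂ), fun z hz => ?_, fun z _ => hsq _⟩
    refine (analyticAt_id.sub analyticAt_const).cpow analyticAt_const ?_
    left
    have h1 := abs_re_lt_of_mem_vstrip hz hr
    rw [abs_of_nonpos h] at h1
    have := neg_abs_le z.re
    change 0 < z.re - r.re
    linarith

theorem exists_analytic_sqrt_prod {θ : ℝ≥0∞} (m : Multiset ℂ)
    (hm : ∀ r ∈ m, θ ≤ ENNReal.ofReal |r.re|) :
    ∃ s : ℂ → ℂ, AnalyticOnNhd ℂ s (vstrip θ) ∧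
      ∀ z ∈ vstrip θ, s z ^ 2 = (m.map fun r => z - r).prod := by
  induction m using Multiset.induction_on with
  | empty => exact ⟨fun _ => 1, fun _ _ => analyticAt_const, fun z _ => by simp⟩
  | cons r m ih =>
    obtain ⟨s, hs, hs'⟩ := ih fun r hr => hm r (Multiset.mem_cons_of_mem hr)
    obtain ⟨t, ht, ht'⟩ := exists_analytic_sqrt_sub (hm r (Multiset.mem_cons_self r m))
    refine ⟨fun z => t z * s z, ht.mul hs, fun z hz => ?_⟩
    rw [Multiset.map_cons, Multiset.prod_cons, mul_pow, hs' z hz, ht' z hz]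

theorem eval_eq_leadingCoeff_mul_prod (p : ℂ[X]) (z : ℂ) :
    p.eval z = p.leadingCoeff * (p.roots.map fun r => z - r).prod :=
  (IsAlgClosed.splits p).eval_eq_prod_roots z

/-- A polynomial without zeros in a vertical strip has an analytic square root there. -/
theorem exists_analytic_sqrt_polynomial {θ : ℝ≥0∞} (p : ℂ[X])
    (hp : ∀ r ∈ p.roots, θ ≤ ENNReal.ofReal |r.re|) :
    ∃ s : ℂ → ℂ, AnalyticOnNhd ℂ s (vstrip θ) ∧ ∀ z ∈ vstrip θ, s z ^ 2 = p.eval z := by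
  obtain ⟨s, hs, hs'⟩ := exists_analytic_sqrt_prod p.roots hp
  obtain ⟨c, hc⟩ := IsAlgClosed.exists_pow_nat_eq p.leadingCoeff two_pos
  refine ⟨fun z => c * s z, analyticOnNhd_const.mul hs, fun z hz => ?_⟩
  rw [mul_pow, hc, hs' z hz, eval_eq_leadingCoeff_mul_prod]

/-- Each factor satisfies `|z - r| ≥ |Re r| - |Re z| ≥ δ`, uniformly in the imaginary part. -/
theorem pow_card_le_norm_prod {ρ δ : ℝ} (hδ : 0 ≤ δ) (m : Multiset ℂ)
    (hm : ∀ r ∈ m, ρ + δ ≤ |r.re|) {z : ℂ} (hz : |z.re| ≤ ρ) :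
    δ ^ Multiset.card m ≤ ‖(m.map fun r => z - r).prod‖ := by
  induction m using Multiset.induction_on with
  | empty => simp
  | cons r m ih =>
    have h1 := ih fun r hr => hm r (Multiset.mem_cons_of_mem hr)
    have h2 := hm r (Multiset.mem_cons_self r m)
    have h3 : δ ≤ ‖z - r‖ := by
      have h4 := Complex.abs_re_le_norm (z - r)
      have h5 := abs_sub_abs_le_abs_sub r.re z.re
      rw [abs_sub_comm] at h5
      rw [Complex.sub_re] at h4
      linarith
    rw [Multiset.map_cons, Multiset.prod_cons, norm_mul, Multiset.card_cons, pow_succ']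
    gcongr

/-- A polynomial is bounded below on a vertical strip at positive distance from its zeros. -/
theorem exists_pos_le_norm_eval {p : ℂ[X]} (hp0 : p ≠ 0) {ρ δ : ℝ} (hδ : 0 < δ)
    (hp : ∀ r ∈ p.roots, ρ + δ ≤ |r.re|) :
    ∃ c : ℝ, 0 < c ∧ ∀ z : ℂ, |z.re| ≤ ρ → c ≤ ‖p.eval z‖ := by
  refine ⟨‖p.leadingCoeff‖ * δ ^ Multiset.card p.roots, ?_, fun z hz => ?_⟩
  · have : 0 < ‖p.leadingCoeff‖ := norm_pos_iff.mpr (leadingCoeff_ne_zero.mpr hp0)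
    positivity
  · rw [eval_eq_leadingCoeff_mul_prod, norm_mul]
    gcongr
    exact pow_card_le_norm_prod hδ.le _ hp hz

theorem exists_norm_eval_le (p : ℂ[X]) :
    ∃ c : ℝ, 0 ≤ c ∧ ∀ z : ℂ, ‖p.eval z‖ ≤ c * (1 + ‖z‖) ^ p.natDegree := by
  refine ⟨∑ i ∈ Finset.range (p.natDegree + 1), ‖p.coeff i‖,
    Finset.sum_nonneg fun _ _ => norm_nonneg _, fun z => ?_⟩
  rw [eval_eq_sum_range, Finset.sum_mul]
  refine (norm_sum_le _ _).trans (Finset.sum_le_sum fun i hi => ?_)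
  rw [norm_mul, norm_pow]
  have h0 := norm_nonneg z
  gcongr
  calc ‖z‖ ^ i ≤ (1 + ‖z‖) ^ i := by gcongr; linarith
    _ ≤ (1 + ‖z‖) ^ p.natDegree :=
      pow_le_pow_right₀ (by linarith) (Nat.lt_succ_iff.mp (Finset.mem_range.mp hi))

end Strip

namespace PlantSymbols

variable (S : PlantSymbols)

/-! ### The radicand as a rational function in lowest terms -/

theorem conjPoly_eval_ofReal (p : ℂ[X]) (lam : ℝ) :
    (conjPoly p).eval (lam : ℂ) = conj (p.eval (lam : ℂ)) := by
  have := eval₂_at_apply (p := p) (starRingEnd ℂ) (lam : ℂ)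
  rwa [Complex.conj_ofReal, ← eval_map] at this

theorem neg_I_mul_I_mul (z : ℂ) : -Complex.I * (Complex.I * z) = z := by
  linear_combination (-z) * Complex.I_mul_I

theorem reExt_I_mul (lam : ℝ) : S.reExt (Complex.I * lam) = ((S.a.eval (lam : ℂ)).re : ℂ) := by
  rw [reExt, neg_I_mul_I_mul, rePoly, eval_mul, eval_C, eval_add, conjPoly_eval_ofReal,
    Complex.add_conj]
  push_cast
  ring

theorem denominator_I_mul (lam : ℝ) :
    (S.pB * conjPoly S.pB).eval (-Complex.I * (Complex.I * lam)) ≠ 0 := by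
  rw [neg_I_mul_I_mul, eval_mul, conjPoly_eval_ofReal]
  exact mul_ne_zero (S.pB_ne_zero lam) ((_root_.map_ne_zero _).mpr (S.pB_ne_zero lam))

/-- The radicand of the symbol of the gain. -/
noncomputable def radicand (lam : ℝ) : ℝ :=
  (S.a.eval (lam : ℂ)).re ^ 2 + ‖S.symbB lam / S.symbG lam‖ ^ 2

theorem radicand_pos (lam : ℝ) : 0 < S.radicand lam := by
  have : 0 < ‖S.symbB lam / S.symbG lam‖ :=
    norm_pos_iff.mpr (div_ne_zero (S.symbB_ne_zero lam) (S.symbG_ne_zero lam))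
  rw [radicand]
  positivity

theorem radicandExt_I_mul (lam : ℝ) : S.radicandExt (Complex.I * lam) = (S.radicand lam : ℂ) := by
  rw [radicandExt, reExt_I_mul, neg_I_mul_I_mul, eval_mul, eval_mul, conjPoly_eval_ofReal,
    conjPoly_eval_ofReal, Complex.mul_conj', Complex.mul_conj', radicand, symbB, symbG, norm_div,
    norm_div, norm_div]
  have h1 := norm_ne_zero_iff.mpr S.g_ne_zero
  have h2 := norm_ne_zero_iff.mpr (S.pB_ne_zero lam)
  have h3 := norm_ne_zero_iff.mpr (S.pG_ne_zero lam)
  push_cast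
  field_simp

/-- The denominator of the radicand. -/
noncomputable def radicandDen : ℂ[X] :=
  (C ((‖S.g‖ : ℂ) ^ 2) * (S.pB * conjPoly S.pB)).comp (C (-Complex.I) * X)

/-- The numerator of the radicand. -/
noncomputable def radicandNum : ℂ[X] :=
  (S.rePoly ^ 2 * (C ((‖S.g‖ : ℂ) ^ 2) * (S.pB * conjPoly S.pB)) +
    C ((‖S.b‖ : ℂ) ^ 2) * (S.pG * conjPoly S.pG)).comp (C (-Complex.I) * X)

theorem radicandDen_eval (z : ℂ) : S.radicandDen.eval z =
    (‖S.g‖ : ℂ) ^ 2 * (S.pB * conjPoly S.pB).eval (-Complex.I * z) := by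
  simp only [radicandDen, eval_comp, eval_mul, eval_C, eval_X]

theorem radicandDen_eval_ne_zero {z : ℂ}
    (hz : (S.pB * conjPoly S.pB).eval (-Complex.I * z) ≠ 0) : S.radicandDen.eval z ≠ 0 := by
  rw [radicandDen_eval]
  have := norm_ne_zero_iff.mpr S.g_ne_zero
  exact mul_ne_zero (pow_ne_zero _ (by exact_mod_cast this)) hz

theorem radicandExt_eq_div {z : ℂ} (hz : S.radicandDen.eval z ≠ 0) :
    S.radicandExt z = S.radicandNum.eval z / S.radicandDen.eval z := by
  rw [eq_div_iff hz, radicandExt, radicandDen_eval, add_mul, div_mul_cancel₀]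
  · rw [radicandNum, eval_comp]
    simp only [eval_add, eval_mul, eval_pow, eval_C, eval_X, reExt]
  · rwa [← radicandDen_eval]

/-- Dividing by the gcd leaves coprime `n` and `d`. Punctured limits see only `n / d`, and
coprimality rules out common zeros, so limit zero means a zero of `n` and blow-up a zero of `d`. -/
theorem exists_lowest_terms : ∃ n d : ℂ[X], d ≠ 0 ∧
    (∀ z, S.radicandDen.eval z ≠ 0 → d.eval z ≠ 0 ∧ S.radicandExt z = n.eval z / d.eval z) ∧
    ∀ z : ℂ, n.eval z = 0 ∨ d.eval z = 0 ↔ z ∈ S.branchPoints := by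
  have hD : S.radicandDen ≠ 0 := by
    intro h
    have := S.radicandDen_eval_ne_zero (S.denominator_I_mul 0)
    rw [h, eval_zero] at this
    exact this rfl
  obtain ⟨n, hn⟩ := EuclideanDomain.gcd_dvd_left S.radicandNum S.radicandDen
  obtain ⟨d, hd⟩ := EuclideanDomain.gcd_dvd_right S.radicandNum S.radicandDen
  set h := EuclideanDomain.gcd S.radicandNum S.radicandDen
  have hh : h ≠ 0 := fun h0 => hD (by rw [hd, h0, zero_mul])
  have hd0 : d ≠ 0 := fun h0 => hD (by rw [hd, h0, mul_zero])
  have hcop : IsCoprime n d := by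
    have h1 := EuclideanDomain.gcd_eq_gcd_ab S.radicandNum S.radicandDen
    refine ⟨EuclideanDomain.gcdA S.radicandNum S.radicandDen,
      EuclideanDomain.gcdB S.radicandNum S.radicandDen, mul_left_cancel₀ hh ?_⟩
    linear_combination -h1 - EuclideanDomain.gcdA S.radicandNum S.radicandDen * hn -
      EuclideanDomain.gcdB S.radicandNum S.radicandDen * hd
  have hval : ∀ z, S.radicandDen.eval z ≠ 0 →
      d.eval z ≠ 0 ∧ S.radicandExt z = n.eval z / d.eval z := by
    intro z hz
    have h1 := S.radicandExt_eq_div hz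
    rw [hd, eval_mul] at hz
    rw [hn, hd, eval_mul, eval_mul, mul_div_mul_left _ _ (left_ne_zero_of_mul hz)] at h1
    exact ⟨right_ne_zero_of_mul hz, h1⟩
  -- Thus the conventional values of `radicandExt` at zeros of its denominator cannot affect the
  -- limits.
  have hev : ∀ (p : ℂ[X]), p ≠ 0 → ∀ z₀ : ℂ, ∀ᶠ z in 𝓝[≠] z₀, p.eval z ≠ 0 := by
    intro p hp z₀
    have hfin : {z | p.eval z = 0}.Finite := by
      refine (p.roots.toFinset.finite_toSet).subset fun z hz => ?_
      simpa [hp] using hz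
    exact nhdsNE_le_cofinite z₀ hfin.eventually_cofinite_notMem
  have hnot : ∀ z, n.eval z = 0 → d.eval z = 0 → False := by
    rintro z h1 h2
    obtain ⟨u, v, huv⟩ := hcop
    have := congrArg (eval z) huv
    rw [eval_add, eval_mul, eval_mul, h1, h2] at this
    simp at this
  refine ⟨n, d, hd0, hval, fun z₀ => ?_⟩
  have heq : S.radicandExt =ᶠ[𝓝[≠] z₀] fun z => n.eval z / d.eval z :=
    (hev _ hD z₀).mono fun z hz => (hval z hz).2
  have hnc : Tendsto (fun z => n.eval z) (𝓝[≠] z₀) (𝓝 (n.eval z₀)) :=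
    (n.continuous.tendsto z₀).mono_left nhdsWithin_le_nhds
  have hdc : Tendsto (fun z => d.eval z) (𝓝[≠] z₀) (𝓝 (d.eval z₀)) :=
    (d.continuous.tendsto z₀).mono_left nhdsWithin_le_nhds
  constructor
  · rintro (h1 | h1)
    · left
      have h2 := hnc.div hdc (fun h2 => hnot z₀ h1 h2)
      rw [h1, zero_div] at h2
      exact h2.congr' heq.symm
    · right
      have h2 : Tendsto (fun z => d.eval z / n.eval z) (𝓝[≠] z₀) (𝓝[≠] 0) := by
        refine tendsto_nhdsWithin_iff.mpr ⟨?_, ?_⟩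
        · have h3 := hdc.div hnc (fun h3 => hnot z₀ h3 h1)
          rwa [h1, zero_div] at h3
        · have h4 : n.eval z₀ ≠ 0 := fun h3 => hnot z₀ h3 h1
          filter_upwards [hev d hd0 z₀, hnc.eventually_ne h4] with z h5 h6
          exact div_ne_zero h5 h6
      refine (tendsto_norm_inv_nhdsNE_zero_atTop.comp h2).congr' ?_
      filter_upwards [heq] with z hz
      rw [hz, Function.comp_apply, inv_div]
  · intro hz
    by_contra! hne
    have h2 := (hnc.div hdc hne.2).congr' heq.symm
    rcases hz with hz | hz
    · exact div_ne_zero hne.1 hne.2 (tendsto_nhds_unique h2 hz)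
    · exact not_tendsto_nhds_of_tendsto_atTop hz _ h2.norm

theorem exists_lowest_terms_on_strip : ∃ n d : ℂ[X], n ≠ 0 ∧ d ≠ 0 ∧
    (∀ z, S.radicandDen.eval z ≠ 0 → d.eval z ≠ 0 ∧ S.radicandExt z = n.eval z / d.eval z) ∧
    (∀ z ∈ S.branchPoints, n.eval z = 0 ∨ d.eval z = 0) ∧
    (∀ r ∈ n.roots, S.decayRate ≤ ENNReal.ofReal |r.re|) ∧
    ∀ r ∈ d.roots, S.decayRate ≤ ENNReal.ofReal |r.re| := by
  obtain ⟨n, d, hd, hval, hbr⟩ := S.exists_lowest_terms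
  refine ⟨n, d, ?_, hd, hval, fun z hz => (hbr z).mpr hz, fun r hr => ?_, fun r hr => ?_⟩
  -- A zero numerator would contradict positivity of the radicand at frequency zero.
  · rintro rfl
    have h1 := (hval _ (S.radicandDen_eval_ne_zero (S.denominator_I_mul 0))).2
    rw [S.radicandExt_I_mul, eval_zero, zero_div] at h1
    exact (S.radicand_pos 0).ne' (by exact_mod_cast h1)
  · exact iInf₂_le r ((hbr r).mp (Or.inl (isRoot_of_mem_roots hr)))
  · exact iInf₂_le r ((hbr r).mp (Or.inr (isRoot_of_mem_roots hr)))

theorem finite_branchPoints : S.branchPoints.Finite := by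
  obtain ⟨n, d, hn, hd, -, hbr, -⟩ := S.exists_lowest_terms_on_strip
  refine ((n * d).roots.toFinset.finite_toSet).subset fun z hz => ?_
  have := hbr z hz
  simpa [hn, hd] using this

theorem re_ne_zero_of_mem_branchPoints {z : ℂ} (hz : z ∈ S.branchPoints) : z.re ≠ 0 := by
  intro h0
  obtain ⟨n, d, -, -, hval, hbr, -⟩ := S.exists_lowest_terms_on_strip
  have hz' : z = Complex.I * (z.im : ℂ) := by
    apply Complex.ext <;> simp [h0]
  obtain ⟨h1, h2⟩ := hval _ (S.radicandDen_eval_ne_zero (S.denominator_I_mul z.im))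
  rw [S.radicandExt_I_mul, ← hz'] at h2
  rw [← hz'] at h1
  rcases hbr z hz with h | h
  · rw [h, zero_div] at h2
    exact (S.radicand_pos z.im).ne' (by exact_mod_cast h2)
  · exact h1 h

theorem decayRate_pos : 0 < S.decayRate := by
  rcases S.branchPoints.eq_empty_or_nonempty with h | h
  · simp [decayRate, h]
  · obtain ⟨z₀, hz₀, hmin⟩ := S.finite_branchPoints.exists_minimalFor (fun z => |z.re|) _ h
    have h1 : ENNReal.ofReal |z₀.re| ≤ S.decayRate :=
      le_iInf₂ fun z hz => ENNReal.ofReal_le_ofReal (by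
        rcases le_total |z₀.re| |z.re| with h | h
        · exact h
        · exact hmin hz h)
    exact (ENNReal.ofReal_pos.mpr
      (abs_pos.mpr (S.re_ne_zero_of_mem_branchPoints hz₀))).trans_le h1

theorem exists_bound_lt_decayRate {K : Set ℝ} (hK : IsCompact K)
    (hK' : ∀ r ∈ K, ENNReal.ofReal |r| < S.decayRate) :
    ∃ ρ δ : ℝ, 0 < δ ∧ ENNReal.ofReal (ρ + δ) ≤ S.decayRate ∧ ∀ r ∈ K, |r| ≤ ρ := by
  -- Inserting `0` gives a maximum even for empty `K`; the new point is admissible because the decay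
  -- rate is positive.
  obtain ⟨r₀, hr₀, hmax⟩ := (hK.insert 0).exists_isMaxOn (Set.insert_nonempty _ _)
    continuous_abs.continuousOn
  have h0 : ENNReal.ofReal |r₀| < S.decayRate := by
    rcases hr₀ with rfl | h
    · simpa using S.decayRate_pos
    · exact hK' _ h
  obtain ⟨t, ht0, ht1, ht2⟩ := ENNReal.lt_iff_exists_real_btwn.mp h0
  have h1 : |r₀| < t := (ENNReal.ofReal_lt_ofReal_iff_of_nonneg (abs_nonneg _)).mp ht1
  exact ⟨|r₀|, t - |r₀|, sub_pos.mpr h1, by rw [add_sub_cancel]; exact ht2.le,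
    fun r hr => hmax (Set.mem_insert_of_mem _ hr)⟩

/-! ### The extension of the gain symbol -/

/-- An analytic square root of the radicand on the strip, positive on the imaginary axis. -/
theorem exists_analytic_sqrt_radicand : ∃ s : ℂ → ℂ, AnalyticOnNhd ℂ s S.strip ∧
    (∀ z ∈ S.strip, S.radicandDen.eval z ≠ 0 → s z ^ 2 = S.radicandExt z) ∧
    (∀ lam : ℝ, s (Complex.I * lam) = (√(S.radicand lam) : ℂ)) ∧
    ∀ K : Set ℝ, IsCompact K → (∀ r ∈ K, ENNReal.ofReal |r| < S.decayRate) →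
      ∃ (c : ℝ) (N : ℕ), 0 ≤ c ∧ ∀ z : ℂ, z.re ∈ K → ‖s z‖ ≤ c * (1 + ‖z‖) ^ N := by
  obtain ⟨n, d, hn, hd, hval, -, hnr, hdr⟩ := S.exists_lowest_terms_on_strip
  obtain ⟨t, ht, ht'⟩ := exists_analytic_sqrt_polynomial n hnr
  obtain ⟨u, hu, hu'⟩ := exists_analytic_sqrt_polynomial d hdr
  have hd0 : ∀ z ∈ S.strip, d.eval z ≠ 0 := fun z hz h => by
    have := abs_re_lt_of_mem_vstrip hz (hdr z ((mem_roots hd).mpr h))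
    exact lt_irrefl _ this
  have hu0 : ∀ z ∈ S.strip, u z ≠ 0 := fun z hz h => hd0 z hz (by rw [← hu' z hz, h]; simp)
  let s : ℂ → ℂ := fun z => t z / u z
  have hs : AnalyticOnNhd ℂ s S.strip := ht.div hu hu0
  have hsq : ∀ z ∈ S.strip, s z ^ 2 = n.eval z / d.eval z := fun z hz => by
    rw [div_pow, ht' z hz, hu' z hz]
  have hmem : ∀ lam : ℝ, Complex.I * lam ∈ S.strip := fun lam => by
    change ENNReal.ofReal |(Complex.I * lam).re| < _
    simpa using S.decayRate_pos
  have hbound : ∀ K : Set ℝ, IsCompact K → (∀ r ∈ K, ENNReal.ofReal |r| < S.decayRate) →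
      ∃ (c : ℝ) (N : ℕ), 0 ≤ c ∧ ∀ z : ℂ, z.re ∈ K → ‖s z‖ ≤ c * (1 + ‖z‖) ^ N := by
    intro K hK hK'
    obtain ⟨ρ, δ, hδ, hρ, hKρ⟩ := S.exists_bound_lt_decayRate hK hK'
    have hroot : ∀ r ∈ d.roots, ρ + δ ≤ |r.re| := fun r hr =>
      (ENNReal.ofReal_le_ofReal_iff (abs_nonneg _)).mp (hρ.trans (hdr r hr))
    obtain ⟨e, he, he'⟩ := exists_pos_le_norm_eval hd hδ hroot
    obtain ⟨c, hc, hc'⟩ := exists_norm_eval_le n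
    -- The bound on `‖s‖²` passes to `‖s‖` through `‖s‖ ≤ 1 + ‖s‖²`, which accounts for the added
    -- `1`.
    refine ⟨1 + c / e, n.natDegree, by positivity, fun z hz => ?_⟩
    have h1 : ‖s z‖ ^ 2 ≤ c / e * (1 + ‖z‖) ^ n.natDegree := by
      rw [← norm_pow, hsq z (hK' _ hz), norm_div, div_mul_eq_mul_div]
      exact div_le_div₀ (by positivity) (hc' z) he (he' z (hKρ _ hz))
    have h2 : 1 ≤ (1 + ‖z‖) ^ n.natDegree := one_le_pow₀ (by linarith [norm_nonneg z])
    nlinarith [sq_nonneg (‖s z‖ - 1), norm_nonneg (s z)]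
  have himag : ∀ lam : ℝ, s (Complex.I * lam) ^ 2 = (S.radicand lam : ℂ) := fun lam => by
    rw [hsq _ (hmem lam), ← S.radicandExt_I_mul,
      (hval _ (S.radicandDen_eval_ne_zero (S.denominator_I_mul lam))).2]
  have hcont : Continuous fun lam : ℝ => s (Complex.I * lam) :=
    continuous_iff_continuousAt.mpr fun lam =>
      ((hs _ (hmem lam)).continuousAt (x := Complex.I * (lam : ℂ))).comp
        (f := fun lam : ℝ => Complex.I * (lam : ℂ)) (by fun_prop)
  have hcont' : Continuous fun lam : ℝ => (√(S.radicand lam) : ℂ) := by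
    have h := (S.continuous_gainSymbol.sub (Complex.continuous_re.comp S.continuous_symbA))
    have h' : (fun lam : ℝ => (√(S.radicand lam) : ℂ)) =
        fun lam => ((S.gainSymbol lam - (S.a.eval (lam : ℂ)).re : ℝ) : ℂ) := by
      funext lam
      rw [gainSymbol, radicand, add_sub_cancel_left]
    rw [h']
    exact Complex.continuous_ofReal.comp h
  -- Two continuous square roots of a nonvanishing function on the connected line differ by one
  -- global sign.
  have hsign := isPreconnected_univ.eq_or_eq_neg_of_sq_eq hcont.continuousOn hcont'.continuousOn
    (fun lam _ => by
      simp only [Pi.pow_apply, himag lam]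
      rw [← Complex.ofReal_pow, Real.sq_sqrt (S.radicand_pos lam).le])
    (fun {lam} _ => by
      exact_mod_cast (Real.sqrt_pos.mpr (S.radicand_pos lam)).ne')
  have hrad : ∀ z ∈ S.strip, S.radicandDen.eval z ≠ 0 → s z ^ 2 = S.radicandExt z :=
    fun z hz hz' => by rw [hsq z hz, (hval z hz').2]
  rcases hsign with h | h
  · exact ⟨s, hs, hrad, fun lam => h (Set.mem_univ lam), hbound⟩
  · refine ⟨fun z => -s z, hs.neg, fun z hz hz' => by rw [neg_sq, hrad z hz hz'], fun lam => ?_, ?_⟩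
    · have := h (Set.mem_univ lam)
      simp only [Pi.neg_apply] at this
      simp only [this, neg_neg]
    · simpa only [norm_neg] using hbound

theorem exists_gainExtension : ∃ F : ℂ → ℂ, S.IsGainExtension F ∧ AnalyticOnNhd ℂ F S.strip ∧
    ∀ K : Set ℝ, IsCompact K → (∀ r ∈ K, ENNReal.ofReal |r| < S.decayRate) →
      ∃ (c : ℝ) (N : ℕ), 0 < c ∧ 0 < N ∧ ∀ z : ℂ, z.re ∈ K → ‖F z‖ ≤ c * (1 + ‖z‖) ^ N := by
  obtain ⟨s, hs, hsq, himag, hbound⟩ := S.exists_analytic_sqrt_radicand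
  have hre : ∀ z, S.reExt z = (S.rePoly.comp (C (-Complex.I) * X)).eval z := fun z => by
    rw [reExt, eval_comp, eval_mul, eval_C, eval_X]
  refine ⟨fun z => S.reExt z + s z, ⟨fun z hz hz' => ?_, fun lam => ?_⟩, ?_, fun K hK hK' => ?_⟩
  · rw [add_sub_cancel_left, hsq z hz (S.radicandDen_eval_ne_zero hz')]
  · simp only [reExt_I_mul, himag, gainSymbol, radicand, Complex.ofReal_add]
  · refine AnalyticOnNhd.add ?_ hs
    simp only [funext hre]
    exact fun z _ => (Polynomial.differentiable _).analyticAt z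
  · obtain ⟨c, N, hc, hcN⟩ := hbound K hK hK'
    obtain ⟨c', hc', hcN'⟩ := exists_norm_eval_le (S.rePoly.comp (C (-Complex.I) * X))
    set N' := (S.rePoly.comp (C (-Complex.I) * X)).natDegree
    refine ⟨c' + c + 1, N' + N + 1, by positivity, by positivity, fun z hz => ?_⟩
    have h1 : 1 ≤ 1 + ‖z‖ := by linarith [norm_nonneg z]
    calc ‖S.reExt z + s z‖ ≤ ‖S.reExt z‖ + ‖s z‖ := norm_add_le _ _
      _ ≤ c' * (1 + ‖z‖) ^ N' + c * (1 + ‖z‖) ^ N := by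
        refine add_le_add ?_ (hcN z hz)
        rw [hre]
        exact hcN' z
      _ ≤ c' * (1 + ‖z‖) ^ (N' + N + 1) + c * (1 + ‖z‖) ^ (N' + N + 1) := by
        gcongr <;> first | exact h1 | omega
      _ ≤ (c' + c + 1) * (1 + ‖z‖) ^ (N' + N + 1) := by
        have : 0 ≤ (1 + ‖z‖) ^ (N' + N + 1) := by positivity
        nlinarith

end PlantSymbols

/-! ### Polynomially bounded multipliers as tempered distributions -/

section PolynomialGrowth

/-- The function `m` is continuous and polynomially bounded. -/
def IsPolyBounded (m : ℝ → ℂ) : Prop :=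
  Continuous m ∧ ∃ (c : ℝ) (N : ℕ), ∀ ξ, ‖m ξ‖ ≤ c * (1 + |ξ|) ^ N

/-- The smooth factor, of temperate growth, acts on Schwartz functions, and the bounded factor is an
`L^∞` distribution. Here `1 + |ξ| ≤ 2 (1 + ξ²)` supplies the smooth weight. -/
theorem IsPolyBounded.exists_eq_mul {m : ℝ → ℂ} (hm : IsPolyBounded m) :
    ∃ g b : ℝ → ℂ, g.HasTemperateGrowth ∧ Continuous b ∧ (∃ c, ∀ ξ, ‖b ξ‖ ≤ c) ∧
      ∀ ξ, m ξ = g ξ * b ξ := by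
  obtain ⟨hc, c, N, hcN⟩ := hm
  have hpos : ∀ ξ : ℝ, 0 < 2 * (1 + ξ ^ 2) := fun ξ => by positivity
  have hne : ∀ ξ : ℝ, ((2 * (1 + ξ ^ 2) : ℝ) : ℂ) ^ N ≠ 0 := fun ξ =>
    pow_ne_zero _ (Complex.ofReal_ne_zero.mpr (hpos ξ).ne')
  refine ⟨fun ξ => ((2 * (1 + ξ ^ 2) : ℝ) : ℂ) ^ N,
    fun ξ => m ξ / ((2 * (1 + ξ ^ 2) : ℝ) : ℂ) ^ N, ?_, ?_, ⟨c, fun ξ => ?_⟩, fun ξ => ?_⟩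
  · fun_prop
  · exact hc.div (by fun_prop) hne
  · rw [norm_div, norm_pow, Complex.norm_of_nonneg (hpos ξ).le, div_le_iff₀ (by positivity)]
    have hc0 : 0 ≤ c := by
      have := (norm_nonneg _).trans (hcN 0)
      simpa using this
    refine (hcN ξ).trans ?_
    gcongr
    nlinarith [sq_abs ξ, sq_nonneg (|ξ| - 1), abs_nonneg ξ]
  · rw [mul_div_cancel₀ _ (hne ξ)]

theorem IsPolyBounded.integrable_mul {m : ℝ → ℂ} (hm : IsPolyBounded m) (ψ : 𝓢(ℝ, ℂ)) :
    Integrable fun ξ => m ξ * ψ ξ := by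
  obtain ⟨g, b, hg, hb, ⟨c, hc⟩, h⟩ := hm.exists_eq_mul
  have h1 : Integrable fun ξ => b ξ * (SchwartzMap.smulLeftCLM ℂ g ψ) ξ :=
    ((SchwartzMap.smulLeftCLM ℂ g ψ).integrable).bdd_mul hb.aestronglyMeasurable
      (ae_of_all _ hc)
  refine h1.congr (ae_of_all _ fun ξ => ?_)
  simp only [SchwartzMap.smulLeftCLM_apply_apply hg, h, smul_eq_mul]
  ring

theorem IsPolyBounded.exists_distribution {m : ℝ → ℂ} (hm : IsPolyBounded m) :
    ∃ T : 𝓢'(ℝ, ℂ), ∀ ψ : 𝓢(ℝ, ℂ), T ψ = ∫ ξ, m ξ * ψ ξ := by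
  obtain ⟨g, b, hg, hb, ⟨c, hc⟩, h⟩ := hm.exists_eq_mul
  have hb' : MemLp b ∞ volume := memLp_top_of_bound hb.aestronglyMeasurable c (ae_of_all _ hc)
  refine ⟨TemperedDistribution.smulLeftCLM ℂ g (Lp.toTemperedDistribution (hb'.toLp b)),
    fun ψ => ?_⟩
  rw [TemperedDistribution.smulLeftCLM_apply_apply, Lp.toTemperedDistribution_apply]
  apply integral_congr_ae
  filter_upwards [hb'.coeFn_toLp] with ξ hξ
  simp only [SchwartzMap.smulLeftCLM_apply_apply hg, h, hξ, smul_eq_mul]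
  ring

/-- Convolution kernels are inverse Fourier transforms of symbols. -/
theorem IsPolyBounded.exists_kernel {m : ℝ → ℂ} (hm : IsPolyBounded m) :
    ∃ T : 𝓢'(ℝ, ℂ), ∀ ψ : 𝓢(ℝ, ℂ), T ψ = ∫ ξ, m ξ * (𝓕⁻ ψ : 𝓢(ℝ, ℂ)) ξ := by
  obtain ⟨T, hT⟩ := hm.exists_distribution
  exact ⟨𝓕⁻ T, fun ψ => by rw [TemperedDistribution.fourierInv_apply, hT]⟩

theorem hasTemperateGrowth_eval (p : ℂ[X]) (a : ℝ) :
    (fun ξ : ℝ => p.eval ((a * ξ : ℝ) : ℂ)).HasTemperateGrowth := by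
  simp only [eval_eq_sum_range]
  fun_prop

end PolynomialGrowth

/-! ### Inversion of the Fourier transform on `L¹ ∩ L²` -/

theorem fourierInv_mul_integral {f g : ℝ → ℂ} (hf : Integrable f) (hg : Integrable g) :
    ∫ ξ, (𝓕⁻ f : ℝ → ℂ) ξ * g ξ = ∫ x, f x * (𝓕⁻ g : ℝ → ℂ) x := by
  have := VectorFourier.integral_fourierIntegral_smul_eq_flip (L := -innerₗ ℝ)
    (μ := (volume : Measure ℝ)) (ν := (volume : Measure ℝ)) (f := f) (g := g)
    Real.continuous_fourierChar (by simp; fun_prop) hf hg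
  have hflip : (-innerₗ ℝ : ℝ →ₗ[ℝ] ℝ →ₗ[ℝ] ℝ).flip = -innerₗ ℝ := by
    ext
    simp
  rw [hflip] at this
  exact this

theorem continuous_fourierInv {g : ℝ → ℂ} (hg : Integrable g) : Continuous (𝓕⁻ g : ℝ → ℂ) := by
  exact VectorFourier.fourierIntegral_continuous Real.continuous_fourierChar
    (by simp; fun_prop) hg

/-- Duality links the `L²` transform to the integral formula: both sides are locally integrable and
agree against every test function, since the inverse transform can be moved onto the test function.
-/
theorem ae_eq_fourierInv {u : L2R} {g : ℝ → ℂ} (hg : Integrable g)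
    (h : (𝓕 u : L2R) =ᵐ[volume] g) : u =ᵐ[volume] (𝓕⁻ g : ℝ → ℂ) := by
  apply ae_eq_of_integral_contDiff_smul_eq
  · exact (Lp.memLp u).locallyIntegrable (by norm_num)
  · exact (continuous_fourierInv hg).locallyIntegrable
  · intro w hw hw'
    have hg₁ : HasCompactSupport (Complex.ofRealCLM ∘ w) := hw'.comp_left rfl
    have hg₂ : ContDiff ℝ ((⊤ : ℕ∞) : WithTop ℕ∞) (Complex.ofRealCLM ∘ w) := by fun_prop
    let ψ : 𝓢(ℝ, ℂ) := hg₁.toSchwartzMap hg₂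
    have hψ : ∀ x, ψ x = (w x : ℂ) := fun x => rfl
    have h1 := DFunLike.congr_fun (Lp.fourier_toTemperedDistribution_eq u) (𝓕⁻ ψ)
    rw [TemperedDistribution.fourier_apply, FourierTransform.fourier_fourierInv_eq,
      Lp.toTemperedDistribution_apply, Lp.toTemperedDistribution_apply] at h1
    have h2 : ∫ ξ, (𝓕⁻ ψ : 𝓢(ℝ, ℂ)) ξ • (𝓕 u : L2R) ξ = ∫ ξ, (𝓕⁻ (ψ : ℝ → ℂ)) ξ * g ξ := by
      apply integral_congr_ae
      filter_upwards [h] with ξ hξ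
      rw [hξ, SchwartzMap.fourierInv_coe, smul_eq_mul]
    rw [h2, fourierInv_mul_integral ψ.integrable hg] at h1
    simpa only [hψ, Complex.real_smul, smul_eq_mul] using h1

/-! ### The convolution kernel of the gain -/

theorem fourierInv_reflect (φ ψ : 𝓢(ℝ, ℂ)) (x : ℝ) (h : ∀ s, ψ s = φ (x - s)) (ξ : ℝ) :
    (𝓕⁻ (ψ : ℝ → ℂ)) ξ = Complex.exp ((2 * Real.pi * (ξ * x) : ℝ) * Complex.I) *
      (𝓕 (φ : ℝ → ℂ)) ξ := by
  rw [Real.fourierInv_eq', Real.fourier_real_eq_integral_exp_smul, ← integral_const_mul,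
    ← integral_sub_left_eq_self _ _ x]
  congr 1
  funext s
  rw [h, sub_sub_cancel, smul_eq_mul, smul_eq_mul, ← mul_assoc, ← Complex.exp_add]
  congr 2
  simp only [RCLike.inner_apply, conj_trivial]
  push_cast
  ring

theorem isConvolutionKernel_kalmanGain {S : PlantSymbols} {G P : L2R →L[ℂ] L2R}
    (hG : HasBoundedFourierSymbol G S.symbG) (hP : HasBoundedFourierSymbol P S.contP)
    (hm : IsPolyBounded fun ξ => (S.gainSymbol (2 * Real.pi * ξ) : ℂ)) {L : 𝓢'(ℝ, ℂ)}
    (hL : ∀ ψ : 𝓢(ℝ, ℂ),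
      L ψ = ∫ ξ : ℝ, (S.gainSymbol (2 * Real.pi * ξ) : ℂ) * (𝓕⁻ ψ : 𝓢(ℝ, ℂ)) ξ) :
    IsConvolutionKernel (kalmanGain G P) L := by
  intro φ
  -- This is `1 / |G^|²`, a polynomial because `G^` has a constant numerator. Hence `φ^ / |G^|²` is
  -- again Schwartz, and `φ` lies in the range of `G G*`.
  let q : ℝ → ℂ := fun ξ =>
    (C ((‖S.g‖ : ℂ) ^ 2)⁻¹ * (S.pG * conjPoly S.pG)).eval ((2 * Real.pi * ξ : ℝ) : ℂ)
  have hq : q.HasTemperateGrowth := hasTemperateGrowth_eval _ _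
  have hGq : ∀ ξ : ℝ, S.symbG (2 * Real.pi * ξ) * conj (S.symbG (2 * Real.pi * ξ)) * q ξ = 1 := by
    intro ξ
    have h1 := S.pG_ne_zero (2 * Real.pi * ξ)
    have h2 : conj (S.pG.eval ((2 * Real.pi * ξ : ℝ) : ℂ)) ≠ 0 := (_root_.map_ne_zero _).mpr h1
    have h3 := S.g_ne_zero
    have h4 : conj S.g ≠ 0 := (_root_.map_ne_zero _).mpr h3
    simp only [q, eval_mul, eval_C, PlantSymbols.conjPoly_eval_ofReal, PlantSymbols.symbG, map_div₀,
      ← Complex.mul_conj']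
    field_simp
  let w : 𝓢(ℝ, ℂ) := SchwartzMap.smulLeftCLM ℂ q (𝓕 φ)
  let s : L2R := (𝓕⁻ w).toLp 2 volume
  have hs : (𝓕 s : L2R) =ᵐ[volume] fun ξ => q ξ * (𝓕 φ : 𝓢(ℝ, ℂ)) ξ := by
    have h1 : (𝓕 s : L2R) = w.toLp 2 volume := by
      rw [SchwartzMap.toLp_fourier_eq, FourierTransform.fourier_fourierInv_eq]
    rw [h1]
    filter_upwards [w.coeFn_toLp 2 volume] with ξ h2
    rw [h2, SchwartzMap.smulLeftCLM_apply_apply hq, smul_eq_mul]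
  have hsφ : G (ContinuousLinearMap.adjoint G s) = φ.toLp 2 volume := by
    apply fourier_injective
    have h1 : (𝓕 (φ.toLp 2 volume) : L2R) = (𝓕 φ : 𝓢(ℝ, ℂ)).toLp 2 volume :=
      SchwartzMap.toLp_fourier_eq φ
    rw [h1]
    filter_upwards [(𝓕 φ : 𝓢(ℝ, ℂ)).coeFn_toLp 2 volume, hs,
      hasBoundedFourierSymbol_comp S.contG (star S.contG) hG
        (hasBoundedFourierSymbol_adjoint S.contG hG) s] with ξ h2 h3 h4
    rw [ContinuousLinearMap.comp_apply] at h4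
    rw [h2, h4, h3, ← mul_assoc]
    change (S.symbG _ * conj (S.symbG _)) * q ξ * _ = _
    rw [hGq, one_mul]
  refine ⟨P s, (mem_graph_kalmanGain (injective_noiseCov hG)).mpr ⟨s, hsφ, rfl⟩, ?_⟩
  have hy : (𝓕 (P s) : L2R) =ᵐ[volume]
      fun ξ => (S.gainSymbol (2 * Real.pi * ξ) : ℂ) * (𝓕 φ : 𝓢(ℝ, ℂ)) ξ := by
    filter_upwards [hP s, hs] with ξ h1 h2
    rw [h1, h2]
    change S.symbG _ * conj (S.symbG _) * (S.gainSymbol _ : ℂ) * _ = _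
    linear_combination (S.gainSymbol (2 * Real.pi * ξ) : ℂ) * (𝓕 φ : 𝓢(ℝ, ℂ)) ξ * hGq ξ
  filter_upwards [ae_eq_fourierInv (hm.integrable_mul (𝓕 φ)) hy] with x hx ψ hψ
  rw [hx, hL, Real.fourierInv_eq']
  congr 1
  funext ξ
  rw [SchwartzMap.fourierInv_coe, fourierInv_reflect φ ψ x hψ ξ, SchwartzMap.fourier_coe,
    smul_eq_mul]
  simp only [RCLike.inner_apply, conj_trivial]
  rw [mul_comm x ξ]
  ring

/-! ### The Fourier-Laplace transform of a test function -/

section Laplace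

/-- The bilateral Laplace transform `∫ φ(x) e^{zx} dx`. -/
noncomputable def laplace (φ : ℝ → ℂ) (z : ℂ) : ℂ := ∫ x : ℝ, φ x * Complex.exp (z * x)

theorem integrable_mul_exp {φ : ℝ → ℂ} (hφ : Continuous φ) (hc : HasCompactSupport φ) (z : ℂ) :
    Integrable fun x : ℝ => φ x * Complex.exp (z * x) :=
  (by fun_prop : Continuous fun x : ℝ => φ x * Complex.exp (z * x)).integrable_of_hasCompactSupport
    hc.mul_right

theorem norm_cexp_mul_le {ρ : ℝ} {z : ℂ} (hz : |z.re| ≤ ρ) (x : ℝ) :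
    ‖Complex.exp (z * x)‖ ≤ Real.exp (ρ * |x|) := by
  rw [Complex.norm_exp, Complex.re_mul_ofReal, Real.exp_le_exp]
  calc z.re * x ≤ |z.re * x| := le_abs_self _
    _ = |z.re| * |x| := abs_mul _ _
    _ ≤ ρ * |x| := by gcongr

theorem differentiable_laplace {φ : ℝ → ℂ} (hφ : Continuous φ) (hc : HasCompactSupport φ) :
    Differentiable ℂ (laplace φ) := by
  intro z₀
  let bound : ℝ → ℝ := fun x => ‖φ x‖ * (|x| * Real.exp ((|z₀.re| + 1) * |x|))
  have hb : Integrable bound :=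
    (by fun_prop : Continuous bound).integrable_of_hasCompactSupport hc.norm.mul_right
  refine (hasDerivAt_integral_of_dominated_loc_of_deriv_le (Metric.ball_mem_nhds z₀ one_pos)
    (F' := fun z (x : ℝ) => φ x * (Complex.exp (z * x) * x)) (bound := bound)
    (Eventually.of_forall fun z => (integrable_mul_exp hφ hc z).aestronglyMeasurable)
    (integrable_mul_exp hφ hc z₀) ?_ (ae_of_all _ fun x z hz => ?_) hb
    (ae_of_all _ fun x z _ => ?_)).2.differentiableAt
  · exact (by fun_prop : Continuous fun x : ℝ =>
      φ x * (Complex.exp (z₀ * x) * x)).aestronglyMeasurable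
  · have h1 : |z.re| ≤ |z₀.re| + 1 := by
      have h2 := Complex.abs_re_le_norm (z - z₀)
      rw [Metric.mem_ball, dist_eq_norm] at hz
      have h3 := abs_sub_abs_le_abs_sub z.re z₀.re
      rw [Complex.sub_re] at h2
      linarith
    rw [norm_mul, norm_mul, Complex.norm_real, Real.norm_eq_abs, mul_comm (‖Complex.exp _‖)]
    have := norm_cexp_mul_le h1 x
    simp only [bound]
    gcongr
  · have h1 : HasDerivAt (fun z : ℂ => z * (x : ℂ)) (x : ℂ) z := by
      simpa using (hasDerivAt_id z).mul_const (x : ℂ)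
    exact h1.cexp.const_mul (φ x)

theorem laplace_derivCLM (φ : 𝓢(ℝ, ℂ)) (hc : HasCompactSupport φ) (z : ℂ) :
    laplace (SchwartzMap.derivCLM ℂ ℂ φ) z = -(z * laplace φ z) := by
  have hc' : HasCompactSupport (SchwartzMap.derivCLM ℂ ℂ φ) := by
    have : (SchwartzMap.derivCLM ℂ ℂ φ : ℝ → ℂ) = deriv φ := by
      funext x
      exact SchwartzMap.derivCLM_apply ℂ φ x
    rw [this]
    exact hc.deriv
  have hexp : ∀ x : ℝ, HasDerivAt (fun x : ℝ => Complex.exp (z * x))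
      (z * Complex.exp (z * x)) x := by
    intro x
    have h1 : HasDerivAt (fun x : ℝ => z * (x : ℂ)) z x := by
      simpa using (Complex.ofRealCLM.hasDerivAt (x := x)).const_mul z
    simpa only [mul_comm] using h1.cexp
  have hz : ∀ x : ℝ, φ x * (z * Complex.exp (z * x)) = z * (φ x * Complex.exp (z * x)) :=
    fun x => by ring
  have h := integral_mul_deriv_eq_deriv_mul_of_integrable (u := φ)
    (u' := SchwartzMap.derivCLM ℂ ℂ φ) (v := fun x : ℝ => Complex.exp (z * x))
    (v' := fun x : ℝ => z * Complex.exp (z * x))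
    (fun x _ => by
      rw [SchwartzMap.derivCLM_apply]
      exact φ.hasDerivAt x)
    (fun x _ => hexp x)
    (((integrable_mul_exp φ.continuous hc z).const_mul z).congr
      (ae_of_all _ fun x => (hz x).symm))
    (integrable_mul_exp (SchwartzMap.derivCLM ℂ ℂ φ).continuous hc' z)
    (integrable_mul_exp φ.continuous hc z)
  simp only [hz] at h
  rw [integral_const_mul] at h
  rw [laplace, laplace, h, neg_neg]

/-- Each integration by parts trades a factor `z` for a derivative of `φ`; compact support makes the
bound uniform over the strip. -/
theorem exists_pow_mul_norm_laplace_le (ρ : ℝ) (k : ℕ) :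
    ∀ φ : 𝓢(ℝ, ℂ), HasCompactSupport φ →
      ∃ c : ℝ, ∀ z : ℂ, |z.re| ≤ ρ → ‖z‖ ^ k * ‖laplace φ z‖ ≤ c := by
  induction k with
  | zero =>
    intro φ hc
    refine ⟨∫ x, ‖φ x‖ * Real.exp (ρ * |x|), fun z hz => ?_⟩
    rw [pow_zero, one_mul]
    have hb : Integrable fun x => ‖φ x‖ * Real.exp (ρ * |x|) :=
      (by have := φ.continuous; fun_prop : Continuous fun x =>
        ‖φ x‖ * Real.exp (ρ * |x|)).integrable_of_hasCompactSupport hc.norm.mul_right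
    refine norm_integral_le_of_norm_le hb (ae_of_all _ fun x => ?_)
    rw [norm_mul]
    gcongr
    exact norm_cexp_mul_le hz x
  | succ k ih =>
    intro φ hc
    have hc' : HasCompactSupport (SchwartzMap.derivCLM ℂ ℂ φ) :=
      hc.of_isClosed_subset (isClosed_tsupport _) (SchwartzMap.tsupport_derivCLM_subset ℂ φ)
    obtain ⟨c, h⟩ := ih _ hc'
    refine ⟨c, fun z hz => ?_⟩
    have := h z hz
    rwa [laplace_derivCLM φ hc, norm_neg, norm_mul, ← mul_assoc, ← pow_succ] at this

theorem exists_one_add_pow_mul_norm_laplace_le (ρ : ℝ) (k : ℕ) (φ : 𝓢(ℝ, ℂ))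
    (hc : HasCompactSupport φ) :
    ∃ c : ℝ, ∀ z : ℂ, |z.re| ≤ ρ → (1 + ‖z‖) ^ k * ‖laplace φ z‖ ≤ c := by
  obtain ⟨c₀, h₀⟩ := exists_pow_mul_norm_laplace_le ρ 0 φ hc
  obtain ⟨c₁, h₁⟩ := exists_pow_mul_norm_laplace_le ρ k φ hc
  refine ⟨2 ^ (k - 1) * (c₀ + c₁), fun z hz => ?_⟩
  have h2 := h₀ z hz
  rw [pow_zero, one_mul] at h2
  calc (1 + ‖z‖) ^ k * ‖laplace φ z‖ ≤ 2 ^ (k - 1) * (1 ^ k + ‖z‖ ^ k) * ‖laplace φ z‖ := by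
        gcongr
        exact add_pow_le zero_le_one (norm_nonneg z) k
    _ = 2 ^ (k - 1) * (‖laplace φ z‖ + ‖z‖ ^ k * ‖laplace φ z‖) := by ring
    _ ≤ 2 ^ (k - 1) * (c₀ + c₁) := by
        gcongr
        exact h₁ z hz

end Laplace

/-! ### Shifting vertical contours -/

/-- Vertical lines in a strip can be shifted if the integrand decays quadratically. -/
theorem integral_vertical_shift {H : ℂ → ℂ} {η c : ℝ}
    (hH : ∀ z : ℂ, |z.re| ≤ |η| → DifferentiableAt ℂ H z)
    (hc : ∀ z : ℂ, |z.re| ≤ |η| → ‖H z‖ ≤ c * (1 + z.im ^ 2)⁻¹) :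
    ∫ y : ℝ, H (η + y * Complex.I) = ∫ y : ℝ, H (y * Complex.I) := by
  have hint : ∀ σ : ℝ, |σ| ≤ |η| → Integrable fun y : ℝ => H (σ + y * Complex.I) := by
    intro σ hσ
    have hre : ∀ y : ℝ, |(σ + y * Complex.I : ℂ).re| ≤ |η| := fun y => by simpa using hσ
    refine (integrable_inv_one_add_sq.const_mul c).mono' ?_ (ae_of_all _ fun y => ?_)
    · refine Continuous.aestronglyMeasurable (continuous_iff_continuousAt.mpr fun y => ?_)
      exact ((hH _ (hre y)).continuousAt).comp (f := fun y : ℝ => (σ + y * Complex.I : ℂ))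
        (by fun_prop)
    · simpa using hc _ (hre y)
  have hlim : ∀ σ : ℝ, |σ| ≤ |η| → Tendsto
      (fun R : ℝ => ∫ y in (-R)..R, H (σ + y * Complex.I)) atTop
      (𝓝 (∫ y : ℝ, H (σ + y * Complex.I))) := fun σ hσ =>
    intervalIntegral_tendsto_integral (hint σ hσ) tendsto_neg_atTop_atBot tendsto_id
  have habs : ∀ x ∈ Set.uIcc 0 η, |x| ≤ |η| := by
    intro x hx
    have := Set.abs_sub_left_of_mem_uIcc hx
    simpa using this
  -- The top and bottom edges of the rectangle have fixed length `|η|`, so the quadratic decay makes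
  -- them vanish.
  have hhor : ∀ ε : ℝ, (ε = 1 ∨ ε = -1) → Tendsto
      (fun R : ℝ => ∫ x in (0 : ℝ)..η, H (x + (ε * R : ℝ) * Complex.I)) atTop (𝓝 0) := by
    intro ε hε
    have h1 : Tendsto (fun R : ℝ => c * (1 + R ^ 2)⁻¹ * |η - 0|) atTop (𝓝 (c * 0 * |η - 0|)) := by
      refine ((Tendsto.inv_tendsto_atTop ?_).const_mul c).mul_const _
      exact tendsto_atTop_add_const_left _ _ (tendsto_pow_atTop two_ne_zero)
    rw [mul_zero, zero_mul] at h1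
    refine squeeze_zero_norm (fun R => ?_) h1
    refine intervalIntegral.norm_integral_le_of_norm_le_const fun x hx => ?_
    have h2 := hc (x + (ε * R : ℝ) * Complex.I) (by
      simpa using habs x (Set.uIoc_subset_uIcc hx))
    have h3 : (ε * R) ^ 2 = R ^ 2 := by
      rcases hε with rfl | rfl <;> ring
    have h4 : ((x : ℂ) + (ε * R : ℝ) * Complex.I).im = ε * R := by simp
    rwa [h4, h3] at h2
  have hrect : ∀ R : ℝ, Complex.I • (∫ y in (-R)..R, H (η + y * Complex.I)) =
      Complex.I • (∫ y in (-R)..R, H ((0 : ℝ) + y * Complex.I)) +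
        (∫ x in (0 : ℝ)..η, H (x + (1 * R : ℝ) * Complex.I)) -
        ∫ x in (0 : ℝ)..η, H (x + (-1 * R : ℝ) * Complex.I) := by
    intro R
    have h1 := Complex.integral_boundary_rect_eq_zero_of_differentiableOn H
      (-R * Complex.I) (η + R * Complex.I) (fun z hz => by
        refine (hH z (habs _ ?_)).differentiableWithinAt
        have := hz.1
        simpa using this)
    simp only [Complex.add_re, Complex.mul_re, Complex.neg_re, Complex.neg_im, Complex.ofReal_re,
      Complex.ofReal_im, Complex.I_re, Complex.I_im, Complex.add_im, Complex.mul_im, mul_zero,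
      mul_one, neg_zero, sub_zero, add_zero, zero_add] at h1
    rw [one_mul, neg_one_mul]
    linear_combination h1
  have hL := (hlim η le_rfl).const_smul Complex.I
  have hR := (((hlim 0 (by simp)).const_smul Complex.I).add (hhor 1 (Or.inl rfl))).sub
    (hhor (-1) (Or.inr rfl))
  have := tendsto_nhds_unique hL (hR.congr fun R => (hrect R).symm)
  rw [add_zero, sub_zero] at this
  have h5 := smul_right_injective ℂ Complex.I_ne_zero this
  simpa using h5

/-! ### Exponential weights -/

theorem fourierInv_eq_laplace {φ ψ : 𝓢(ℝ, ℂ)} {η : ℝ}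
    (h : ∀ x : ℝ, ψ x = (Real.exp (-η * x) : ℂ) * φ x) (ξ : ℝ) :
    (𝓕⁻ ψ : 𝓢(ℝ, ℂ)) ξ = laplace φ ((2 * Real.pi * ξ : ℝ) * Complex.I - η) := by
  rw [SchwartzMap.fourierInv_coe, Real.fourierInv_eq', laplace]
  congr 1
  funext x
  rw [h, smul_eq_mul, Complex.ofReal_exp, ← mul_assoc, ← Complex.exp_add, mul_comm (φ x)]
  congr 2
  simp only [RCLike.inner_apply, conj_trivial]
  push_cast
  ring

theorem fourierInv_eq_laplace_zero (φ : 𝓢(ℝ, ℂ)) (ξ : ℝ) :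
    (𝓕⁻ φ : 𝓢(ℝ, ℂ)) ξ = laplace φ ((2 * Real.pi * ξ : ℝ) * Complex.I) := by
  have := fourierInv_eq_laplace (φ := φ) (ψ := φ) (η := 0) (by simp) ξ
  simpa using this

namespace PlantSymbols

variable {S : PlantSymbols} {F : ℂ → ℂ}

theorem mem_strip_of_abs_re_le {η : ℝ} (hη : ENNReal.ofReal |η| < S.decayRate) {z : ℂ}
    (hz : |z.re| ≤ |η|) : z ∈ S.strip :=
  (ENNReal.ofReal_le_ofReal hz).trans_lt hη

theorem isPolyBounded_vertical (hF : AnalyticOnNhd ℂ F S.strip)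
    (hb : ∀ K : Set ℝ, IsCompact K → (∀ r ∈ K, ENNReal.ofReal |r| < S.decayRate) →
      ∃ (c : ℝ) (N : ℕ), 0 < c ∧ 0 < N ∧ ∀ z : ℂ, z.re ∈ K → ‖F z‖ ≤ c * (1 + ‖z‖) ^ N)
    {η : ℝ} (hη : ENNReal.ofReal |η| < S.decayRate) :
    IsPolyBounded fun ξ => F (η + (2 * Real.pi * ξ : ℝ) * Complex.I) := by
  constructor
  · refine continuous_iff_continuousAt.mpr fun ξ => ?_
    exact (hF _ (mem_strip_of_abs_re_le hη (by simp))).continuousAt.comp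
      (f := fun ξ : ℝ => (η + (2 * Real.pi * ξ : ℝ) * Complex.I : ℂ)) (by fun_prop)
  · obtain ⟨c, N, hc, -, h⟩ := hb {η} isCompact_singleton (by simpa using hη)
    refine ⟨c * (1 + |η| + 2 * Real.pi) ^ N, N, fun ξ => (h _ (by simp)).trans ?_⟩
    rw [mul_assoc c, ← mul_pow]
    have hpi := Real.pi_pos
    have h1 : ‖(η + (2 * Real.pi * ξ : ℝ) * Complex.I : ℂ)‖ ≤ |η| + 2 * Real.pi * |ξ| := by
      refine (norm_add_le _ _).trans ?_
      rw [norm_mul, Complex.norm_real, Complex.norm_real, Complex.norm_I, mul_one,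
        Real.norm_eq_abs, Real.norm_eq_abs, abs_mul, abs_of_pos (by positivity : 0 < 2 * Real.pi)]
    gcongr
    nlinarith [abs_nonneg η, abs_nonneg ξ, mul_nonneg (abs_nonneg η) (abs_nonneg ξ)]

theorem isTemperedWithWeight_kernel (hF : AnalyticOnNhd ℂ F S.strip)
    (hb : ∀ K : Set ℝ, IsCompact K → (∀ r ∈ K, ENNReal.ofReal |r| < S.decayRate) →
      ∃ (c : ℝ) (N : ℕ), 0 < c ∧ 0 < N ∧ ∀ z : ℂ, z.re ∈ K → ‖F z‖ ≤ c * (1 + ‖z‖) ^ N)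
    {L : 𝓢'(ℝ, ℂ)}
    (hL : ∀ ψ : 𝓢(ℝ, ℂ),
      L ψ = ∫ ξ : ℝ, F ((2 * Real.pi * ξ : ℝ) * Complex.I) * (𝓕⁻ ψ : 𝓢(ℝ, ℂ)) ξ)
    {η : ℝ} (hη : ENNReal.ofReal |η| < S.decayRate) : IsTemperedWithWeight η L := by
  obtain ⟨T, hT⟩ := (isPolyBounded_vertical hF hb hη).exists_kernel
  refine ⟨T, fun φ ψ hφ hψ => ?_⟩
  -- On `Re z = η` this is the integrand of `T φ`; on `Re z = 0` it is that of `L (e^{-ηx} φ)`, the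
  -- weight being a shift of the Laplace variable.
  let H : ℂ → ℂ := fun z => F z * laplace φ (z - η)
  have hdiff : ∀ z : ℂ, |z.re| ≤ |η| → DifferentiableAt ℂ H z := fun z hz =>
    (hF z (mem_strip_of_abs_re_le hη hz)).differentiableAt.mul
      ((differentiable_laplace φ.continuous hφ _).comp z (by fun_prop))
  obtain ⟨c, N, hc, -, hcN⟩ := hb (Set.Icc (-|η|) |η|) isCompact_Icc fun r hr =>
    (ENNReal.ofReal_le_ofReal (abs_le.mpr hr)).trans_lt hη
  -- The shift by `η` doubles the half-width. Of the exponent, `N` absorbs the growth of `F` and `2`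
  -- gives the quadratic decay.
  obtain ⟨e, he⟩ := exists_one_add_pow_mul_norm_laplace_le (2 * |η|) (N + 2) φ hφ
  have hdecay : ∀ z : ℂ, |z.re| ≤ |η| →
      ‖H z‖ ≤ c * (1 + |η|) ^ N * e * (1 + z.im ^ 2)⁻¹ := by
    intro z hz
    have h1 := hcN z (abs_le.mp hz)
    have h2 := he (z - η) (by
      have := abs_sub z.re η
      simp only [Complex.sub_re, Complex.ofReal_re]
      linarith)
    have h3 : 1 + ‖z‖ ≤ (1 + |η|) * (1 + ‖z - η‖) := by
      have h4 : ‖z‖ ≤ ‖z - η‖ + |η| := by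
        have := norm_add_le (z - η) (η : ℂ)
        rwa [sub_add_cancel, Complex.norm_real, Real.norm_eq_abs] at this
      nlinarith [abs_nonneg η, norm_nonneg (z - η)]
    have h5 : 1 + z.im ^ 2 ≤ (1 + ‖z - η‖) ^ 2 := by
      have h6 := Complex.abs_im_le_norm (z - η)
      simp only [Complex.sub_im, Complex.ofReal_im, sub_zero] at h6
      nlinarith [sq_abs z.im, abs_nonneg z.im, norm_nonneg (z - η)]
    rw [← div_eq_mul_inv, le_div_iff₀ (by positivity), norm_mul]
    calc ‖F z‖ * ‖laplace φ (z - η)‖ * (1 + z.im ^ 2)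
        ≤ c * ((1 + |η|) * (1 + ‖z - η‖)) ^ N * ‖laplace φ (z - η)‖ * (1 + ‖z - η‖) ^ 2 := by
          gcongr
          exact h1.trans (by gcongr)
      _ = c * (1 + |η|) ^ N * ((1 + ‖z - η‖) ^ (N + 2) * ‖laplace φ (z - η)‖) := by
          rw [mul_pow]; ring
      _ ≤ c * (1 + |η|) ^ N * e := by gcongr
  have hshift := integral_vertical_shift hdiff hdecay
  have hscale : ∀ g : ℝ → ℂ, ∫ ξ : ℝ, g (2 * Real.pi * ξ) = |(2 * Real.pi)⁻¹| • ∫ y, g y :=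
    fun g => Measure.integral_comp_mul_left g _
  rw [hT, hL]
  calc ∫ ξ : ℝ, F (η + (2 * Real.pi * ξ : ℝ) * Complex.I) * (𝓕⁻ φ : 𝓢(ℝ, ℂ)) ξ
      = ∫ ξ : ℝ, H (η + (2 * Real.pi * ξ : ℝ) * Complex.I) := by
        congr 1
        funext ξ
        simp only [H, fourierInv_eq_laplace_zero, add_sub_cancel_left]
    _ = ∫ ξ : ℝ, H ((2 * Real.pi * ξ : ℝ) * Complex.I) := by
        rw [hscale fun y => H (η + y * Complex.I), hscale fun y => H (y * Complex.I), hshift]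
    _ = _ := by
        congr 1
        funext ξ
        simp only [H, fourierInv_eq_laplace hψ]

end PlantSymbols

end KalmanGain

/-! ### The main theorem -/

theorem theorem4
    (S : PlantSymbols)
    (A : L2R →ₗ.[ℂ] L2R)
    (hA_dense : Dense (A.domain : Set L2R))
    (hA_diff : IsDifferentialOperator A S.a)
    (hA_gen : ∃ T : C0Semigroup L2R, T.IsGenerator A)
    (B G : L2R →L[ℂ] L2R)
    (hB : HasBoundedFourierSymbol B S.symbB)
    (hG : HasBoundedFourierSymbol G S.symbG)
    (P : L2R →L[ℂ] L2R)
    (hP : IsStabilizingSolution A B G P) :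
    -- the gain operator has the Fourier symbol whose extension is considered
    HasFourierSymbol (kalmanGain G P) (fun lam => (S.gainSymbol lam : ℂ)) ∧
    -- there are finitely many finite branch points, and `θ > 0`
    S.branchPoints.Finite ∧ 0 < S.decayRate ∧
    -- the extension is analytic on the strip and polynomially bounded on closed substrips
    (∃ F : ℂ → ℂ, S.IsGainExtension F ∧ AnalyticOnNhd ℂ F S.strip ∧
      ∀ K : Set ℝ, IsCompact K → (∀ r ∈ K, ENNReal.ofReal |r| < S.decayRate) →
        ∃ (c : ℝ) (N : ℕ), 0 < c ∧ 0 < N ∧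
          ∀ z : ℂ, z.re ∈ K → ‖F z‖ ≤ c * (1 + ‖z‖) ^ N) ∧
    -- spatial decay of the convolution kernel of the gain
    (∃ L : 𝓢'(ℝ, ℂ), IsConvolutionKernel (kalmanGain G P) L ∧
      ∀ η : ℝ, ENNReal.ofReal |η| < S.decayRate → IsTemperedWithWeight η L) := by
  have hPsymb := hasBoundedFourierSymbol_of_stabilizing hA_dense hA_diff hB hG hP
  obtain ⟨F, hext, hF, hbound⟩ := S.exists_gainExtension
  refine ⟨hasFourierSymbol_kalmanGain hG hPsymb, S.finite_branchPoints, S.decayRate_pos,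
    ⟨F, hext, hF, hbound⟩, ?_⟩
  have hgain : ∀ ξ : ℝ, (S.gainSymbol (2 * Real.pi * ξ) : ℂ) =
      F ((2 * Real.pi * ξ : ℝ) * Complex.I) := fun ξ => by
    rw [mul_comm _ Complex.I, hext.2]
  have hpoly : IsPolyBounded fun ξ => (S.gainSymbol (2 * Real.pi * ξ) : ℂ) := by
    -- The symbol is the extension on the line `Re z = 0`, so its polynomial bound is the case `η =
    -- 0`.
    have := PlantSymbols.isPolyBounded_vertical hF hbound (η := 0) (by simpa using S.decayRate_pos)
    simpa only [hgain, Complex.ofReal_zero, zero_add] using this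
  obtain ⟨L, hL⟩ := hpoly.exists_kernel
  exact ⟨L, isConvolutionKernel_kalmanGain hG hPsymb hpoly hL, fun η hη =>
    PlantSymbols.isTemperedWithWeight_kernel hF hbound (by simpa only [hgain] using hL) hη⟩
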